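/- Conventions: $R(X,Y)=[\nabla_X,\nabla_Y]-\nabla_{[X,Y]}$ and $2\,d\eta(X,Y)=X\eta(Y)-Y\eta(X)-\eta([X,Y])$. A homogeneous Riemannian structure on a Riemannian manifold $(M,g)$ with Levi-Civita connection $\nabla$ and curvature $R$ is a smooth $(1,2)$-tensor field $S$ such that $\tilde\nabla=\nabla+S$ satisfies $\tilde\nabla g=0$, $\tilde\nabla R=0$, $\tilde\nabla S=0$. A contact Riemannian 3-manifold $(M;\varphi,\xi,\eta,g)$ satisfies $\varphi^2=-I+\eta\otimes\xi$, $\eta(\xi)=1$, $g(\varphi X,\varphi Y)=g(X,Y)-\eta(X)\eta(Y)$, $d\eta(X,Y)=g(X,\varphi Y)$; put $h=\frac12\mathcal L_\xi\varphi$. It is Sasakian if $(\nabla_X\varphi)Y=g(X,Y)\xi-\eta(Y)X$, and a contact $(\kappa,\mu)$-space ($\kappa,\mu\in\mathbb R$) if $R(X,Y)\xi=(\kappa I+\mu h)(\eta(Y)X-\eta(X)Y)$. On a Lie group with a left invariant metric, $\nabla^{(-)}$ is the connection for which all left invariant vector fields are parallel. Let $M$ be a 3-dimensional non-flat, non-Sasakian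 contact $(\kappa,\mu)$-space, and let Boeckx's tensor field be $$S^B(X)Y=-g(\varphi(I+h)X,Y)\,\xi+\frac{\mu}{2}\,\eta(X)\varphi Y+\eta(Y)\,\varphi(I+h)X.$$ Then: (1) $S^B$ is a homogeneous Riemannian structure. (2) $S^B$ is the one derived from the $(-)$-connection: there are real numbers $c_2\ne c_3$ with $\kappa=1-\frac14(c_2-c_3)^2$ and $\mu=2-(c_2+c_3)$ such that near every point there is a smooth orthonormal frame $e_1=\xi$, $e_2$, $e_3=\varphi e_2$ with $[e_1,e_2]=c_3e_3$, $[e_2,e_3]=2e_1$, $[e_3,e_1]=c_2e_2$ which is parallel for $\nabla+S^B$. Moreover, for every Lie group $G$ with a left invariant contact Riemannian structure and every local isomorphism $f$ of contact Riemannian manifolds from an open subset of $M$ to $G$, $S^B$ corresponds under $f$ to $\nabla^{(-)}-\nabla$ of $G$. (3) If $(2+\mu)^2\ne4(1-\kappa)$, equivalently if the structure constants $2,c_2,c_3$ are distinct, then $S^B$ is the only homogeneous Riemannian structure on $M$. -/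

import Mathlib

open Bundle VectorField
open scoped Manifold ContDiff

noncomputable section

namespace ContactKM

section Riemannian

/-- Vector fields (not necessarily continuous) on a manifold `M` modelled on `E`. -/
abbrev VF (E : Type*) [NormedAddCommGroup E] [NormedSpace ℝ E]
    (M : Type*) [TopologicalSpace M] [ChartedSpace E M] :=
  ∀ x : M, TangentSpace 𝓘(ℝ, E) x

/-- Tensor fields of type `(1,1)` (not necessarily continuous). -/
abbrev Tensor11 (E : Type*) [NormedAddCommGroup E] [NormedSpace ℝ E]
    (M : Type*) [TopologicalSpace M] [ChartedSpace E M] :=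
  ∀ x : M, TangentSpace 𝓘(ℝ, E) x →L[ℝ] TangentSpace 𝓘(ℝ, E) x

/-- Tensor fields of type `(1,2)` (not necessarily continuous); `S x X Y` stands for `S(X)Y`. -/
abbrev Tensor12 (E : Type*) [NormedAddCommGroup E] [NormedSpace ℝ E]
    (M : Type*) [TopologicalSpace M] [ChartedSpace E M] :=
  ∀ x : M, TangentSpace 𝓘(ℝ, E) x →L[ℝ] TangentSpace 𝓘(ℝ, E) x →L[ℝ] TangentSpace 𝓘(ℝ, E) x

/-- Smooth Riemannian metrics on a smooth manifold `M`. -/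
abbrev Metric (E : Type*) [NormedAddCommGroup E] [NormedSpace ℝ E]
    (M : Type*) [TopologicalSpace M] [ChartedSpace E M] [IsManifold 𝓘(ℝ, E) ∞ M] :=
  ContMDiffRiemannianMetric 𝓘(ℝ, E) ∞ E (fun x : M ↦ TangentSpace 𝓘(ℝ, E) x)

/-- Linear connections on (the tangent bundle of) `M`; `D Y x v` stands for `D_v Y` at `x`. -/
abbrev Connection (E : Type*) [NormedAddCommGroup E] [NormedSpace ℝ E]
    (M : Type*) [TopologicalSpace M] [ChartedSpace E M] [IsManifold 𝓘(ℝ, E) ∞ M] :=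
  CovariantDerivative 𝓘(ℝ, E) E (fun x : M ↦ TangentSpace 𝓘(ℝ, E) x)

variable {E : Type*} [NormedAddCommGroup E] [NormedSpace ℝ E]
  {M : Type*} [TopologicalSpace M] [ChartedSpace E M] [IsManifold 𝓘(ℝ, E) ∞ M]

/-- The vector field `X` is smooth on the set `U`. -/
def SmoothOn (X : VF E M) (U : Set M) : Prop :=
  ContMDiffOn 𝓘(ℝ, E) (𝓘(ℝ, E).prod 𝓘(ℝ, E)) ∞
    (fun x ↦ TotalSpace.mk' E (E := fun x : M ↦ TangentSpace 𝓘(ℝ, E) x) x (X x)) U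

/-- The vector field `X` is smooth. -/
def Smooth (X : VF E M) : Prop :=
  ContMDiff 𝓘(ℝ, E) (𝓘(ℝ, E).prod 𝓘(ℝ, E)) ∞
    (fun x ↦ TotalSpace.mk' E (E := fun x : M ↦ TangentSpace 𝓘(ℝ, E) x) x (X x))

/-- The `1`-form `η` is smooth. -/
def SmoothOneForm (η : ∀ x : M, TangentSpace 𝓘(ℝ, E) x →L[ℝ] ℝ) : Prop :=
  ContMDiff 𝓘(ℝ, E) (𝓘(ℝ, E).prod 𝓘(ℝ, E →L[ℝ] ℝ)) ∞
    (fun x ↦ TotalSpace.mk' (E →L[ℝ] ℝ)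
      (E := fun x : M ↦ TangentSpace 𝓘(ℝ, E) x →L[ℝ] ℝ) x (η x))

/-- The `(1,1)`-tensor field `φ` is smooth. -/
def SmoothTensor11 (φ : Tensor11 E M) : Prop :=
  ContMDiff 𝓘(ℝ, E) (𝓘(ℝ, E).prod 𝓘(ℝ, E →L[ℝ] E)) ∞
    (fun x ↦ TotalSpace.mk' (E →L[ℝ] E)
      (E := fun x : M ↦ TangentSpace 𝓘(ℝ, E) x →L[ℝ] TangentSpace 𝓘(ℝ, E) x) x (φ x))

/-- The `(1,2)`-tensor field `S` is smooth. -/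
def SmoothTensor12 (S : Tensor12 E M) : Prop :=
  ContMDiff 𝓘(ℝ, E) (𝓘(ℝ, E).prod 𝓘(ℝ, E →L[ℝ] E →L[ℝ] E)) ∞
    (fun x ↦ TotalSpace.mk' (E →L[ℝ] E →L[ℝ] E)
      (E := fun x : M ↦ TangentSpace 𝓘(ℝ, E) x →L[ℝ] TangentSpace 𝓘(ℝ, E) x →L[ℝ]
        TangentSpace 𝓘(ℝ, E) x) x (S x))

variable (g : Metric E M)

/-- The derivative of the function `g(X, Y)` at `x` in the direction `v`. -/
def dInner (X Y : VF E M) (x : M) (v : TangentSpace 𝓘(ℝ, E) x) : ℝ :=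
  mvfderiv 𝓘(ℝ, E) (fun y ↦ g.inner y (X y) (Y y)) x v

/-- The Koszul expression, which equals `g(∇_X Y, Z)`. -/
def koszul (X Y Z : VF E M) (x : M) : ℝ :=
  (dInner g Y Z x (X x)
    + dInner g X Z x (Y x)
    - dInner g X Y x (Z x)
    + g.inner x (mlieBracket 𝓘(ℝ, E) X Y x) (Z x)
    - g.inner x (mlieBracket 𝓘(ℝ, E) X Z x) (Y x)
    - g.inner x (mlieBracket 𝓘(ℝ, E) Y Z x) (X x)) / 2

variable {X X' Y Y' Z : VF E M} {f : M → ℝ} {x : M}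

theorem dInner_map_add (v w : TangentSpace 𝓘(ℝ, E) x) :
    dInner g X Y x (v + w) = dInner g X Y x v + dInner g X Y x w := map_add _ v w

theorem dInner_map_smul (c : ℝ) (v : TangentSpace 𝓘(ℝ, E) x) :
    dInner g X Y x (c • v) = c * dInner g X Y x v := map_smul _ c v

theorem mdiff_inner (hX : MDiffAt (T% X) x) (hY : MDiffAt (T% Y) x) :
    MDiffAt (fun y ↦ g.inner y (X y) (Y y)) x := by
  have hg := (g.contMDiff.mdifferentiable (by simp)) x
  have := MDifferentiableAt.clm_bundle_apply₂ (F₁ := E) (F₂ := E) (F₃ := ℝ)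
    (E₃ := Bundle.Trivial M ℝ) (b := fun y : M ↦ y) hg hX hY
  simp only [mdifferentiableAt_totalSpace] at this
  exact this.2

theorem deriv_inner_add (hX : MDiffAt (T% X) x) (hX' : MDiffAt (T% X') x)
    (hY : MDiffAt (T% Y) x) (v : TangentSpace 𝓘(ℝ, E) x) :
    dInner g (X + X') Y x v =
      dInner g X Y x v
        + dInner g X' Y x v := by
  simp [dInner, mvfderiv_fun_add (mdiff_inner g hX hY) (mdiff_inner g hX' hY)]

theorem deriv_inner_smul (hf : MDiffAt f x) (hX : MDiffAt (T% X) x)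
    (hY : MDiffAt (T% Y) x) (v : TangentSpace 𝓘(ℝ, E) x) :
    dInner g (f • X) Y x v =
      f x * dInner g X Y x v
        + g.inner x (X x) (Y x) * mvfderiv 𝓘(ℝ, E) f x v := by
  simp [dInner, mvfderiv_fun_mul hf (mdiff_inner g hX hY)]

theorem deriv_inner_comm (v : TangentSpace 𝓘(ℝ, E) x) :
    dInner g X Y x v =
      dInner g Y X x v := by
  simp only [dInner, g.symm _ (X _)]

theorem metric_ext {v w : TangentSpace 𝓘(ℝ, E) x}
    (h : ∀ Z : VF E M, MDiffAt (T% Z) x →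
      g.inner x v (Z x) = g.inner x w (Z x)) : v = w := by
  by_contra hne
  have h1 := h (FiberBundle.extend E (v - w)) (FiberBundle.mdifferentiableAt_extend 𝓘(ℝ, E) E _)
  rw [FiberBundle.extend_apply_self] at h1
  have h2 := g.pos x (v - w) (sub_ne_zero.2 hne)
  rw [map_sub, g.symm x _ v, g.symm x _ w] at h2
  linarith

variable [FiniteDimensional ℝ E]

theorem koszul_tensorial₁ (hY : MDiffAt (T% Y) x) (hZ : MDiffAt (T% Z) x) :
    TensorialAt 𝓘(ℝ, E) E (fun X ↦ koszul g X Y Z x) x where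
  smul {f X} hf hX := by
    simp only [koszul, deriv_inner_smul g hf hX hZ, deriv_inner_smul g hf hX hY,
      mlieBracket_smul_left hf hX, Pi.smul_apply', map_smul, dInner_map_smul, map_add, add_apply, smul_apply,
      smul_eq_mul]
    ring
  add {X X'} hX hX' := by
    simp only [koszul, deriv_inner_add g hX hX' hZ, deriv_inner_add g hX hX' hY,
      mlieBracket_add_left hX hX', Pi.add_apply, dInner_map_add, map_add, add_apply]
    ring

theorem koszul_tensorial₃ (hX : MDiffAt (T% X) x) (hY : MDiffAt (T% Y) x) :
    TensorialAt 𝓘(ℝ, E) E (fun Z ↦ koszul g X Y Z x) x where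
  smul {f Z} hf hZ := by
    simp only [koszul, deriv_inner_comm g (Y := f • Z), deriv_inner_smul g hf hZ hX,
      deriv_inner_smul g hf hZ hY,
      mlieBracket_smul_right hf hZ, Pi.smul_apply', map_smul, dInner_map_smul, map_add, add_apply, smul_apply,
      smul_eq_mul]
    simp only [deriv_inner_comm g (X := Z), g.symm x (Z x)]
    ring
  add {Z Z'} hZ hZ' := by
    simp only [koszul, deriv_inner_comm g (Y := Z + Z'), deriv_inner_add g hZ hZ' hX,
      deriv_inner_add g hZ hZ' hY,
      mlieBracket_add_right hZ hZ', Pi.add_apply, dInner_map_add, map_add, add_apply]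
    simp only [deriv_inner_comm g (X := Z), deriv_inner_comm g (X := Z')]
    ring

theorem koszul_add (hX : MDiffAt (T% X) x) (hY : MDiffAt (T% Y) x) (hY' : MDiffAt (T% Y') x)
    (hZ : MDiffAt (T% Z) x) :
    koszul g X (Y + Y') Z x = koszul g X Y Z x + koszul g X Y' Z x := by
  simp only [koszul, deriv_inner_comm g (Y := Y + Y'), deriv_inner_add g hY hY' hX,
    deriv_inner_add g hY hY' hZ, mlieBracket_add_right hY hY', mlieBracket_add_left hY hY',
    Pi.add_apply, dInner_map_add, map_add, add_apply]
  simp only [deriv_inner_comm g (X := X)]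
  ring

theorem koszul_smul (hX : MDiffAt (T% X) x) (hf : MDiffAt f x) (hY : MDiffAt (T% Y) x)
    (hZ : MDiffAt (T% Z) x) :
    koszul g X (f • Y) Z x =
      f x * koszul g X Y Z x + mvfderiv 𝓘(ℝ, E) f x (X x) * g.inner x (Y x) (Z x) := by
  simp only [koszul, deriv_inner_comm g (Y := f • Y), deriv_inner_smul g hf hY hX,
    deriv_inner_smul g hf hY hZ, mlieBracket_smul_right hf hY, mlieBracket_smul_left hf hY,
    Pi.smul_apply', map_smul, dInner_map_smul, map_add, add_apply, smul_apply, smul_eq_mul]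
  simp only [deriv_inner_comm g (X := X), g.symm x (Y x) (X x)]
  ring

instance tangentFiniteDimensional (x : M) : FiniteDimensional ℝ (TangentSpace 𝓘(ℝ, E) x) :=
  inferInstanceAs (FiniteDimensional ℝ E)

instance tangentT2 (x : M) : T2Space (TangentSpace 𝓘(ℝ, E) x) := inferInstanceAs (T2Space E)

/-- The musical isomorphism `v ↦ g(v, ·)`. -/
def musical (x : M) : TangentSpace 𝓘(ℝ, E) x ≃ₗ[ℝ] (TangentSpace 𝓘(ℝ, E) x →L[ℝ] ℝ) :=
  LinearEquiv.ofInjectiveOfFinrankEq (g.inner x).toLinearMap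
    (fun v w h ↦ metric_ext g fun Z _ ↦ congrArg (fun L ↦ L (Z x)) h)
    (by
      have h := (LinearMap.toContinuousLinearMap (𝕜 := ℝ) (E := TangentSpace 𝓘(ℝ, E) x)
        (F' := ℝ)).finrank_eq
      rw [← h]
      exact Subspace.dual_finrank_eq.symm)

theorem inner_musical_symm (x : M) (L : TangentSpace 𝓘(ℝ, E) x →L[ℝ] ℝ)
    (v : TangentSpace 𝓘(ℝ, E) x) : g.inner x ((musical g x).symm L) v = L v :=
  congrArg (fun L ↦ L v) ((musical g x).apply_symm_apply L)

open scoped Classical in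
/-- `g(∇_X Y, Z)` is the Koszul expression; `∇_X Y` is set to `0` where `Y` is not differentiable. -/
def leviCivitaAux (Y : VF E M) (x : M) :
    TangentSpace 𝓘(ℝ, E) x →L[ℝ] TangentSpace 𝓘(ℝ, E) x :=
  if hY : MDiffAt (T% Y) x then
    LinearMap.toContinuousLinearMap ((musical g x).symm.toLinearMap ∘ₗ
      (TensorialAt.mkHom₂ (fun X Z ↦ koszul g X Y Z x) x (fun _ hZ ↦ koszul_tensorial₁ g hY hZ)
        (fun _ hX ↦ koszul_tensorial₃ g hX hY)).toLinearMap)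
  else 0

theorem inner_leviCivitaAux (hX : MDiffAt (T% X) x) (hY : MDiffAt (T% Y) x)
    (hZ : MDiffAt (T% Z) x) :
    g.inner x (leviCivitaAux g Y x (X x)) (Z x) = koszul g X Y Z x := by
  rw [leviCivitaAux, dif_pos hY]
  exact (inner_musical_symm g x _ _).trans
    (TensorialAt.mkHom₂_apply (Φ := fun X Z ↦ koszul g X Y Z x)
      (fun _ hZ ↦ koszul_tensorial₁ g hY hZ) (fun _ hX ↦ koszul_tensorial₃ g hX hY) hX hZ)

/-- The Levi-Civita connection of `g`. -/
def leviCivita : Connection E M where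
  toFun := leviCivitaAux g
  isCovariantDerivativeOnUniv :=
    { add {Y Y' x} hY hY' _ := by
        ext v
        refine metric_ext g fun Z hZ ↦ ?_
        obtain ⟨X, hX, rfl⟩ : ∃ X : VF E M, MDiffAt (T% X) x ∧ X x = v :=
          ⟨FiberBundle.extend E v, FiberBundle.mdifferentiableAt_extend .., by simp⟩
        rw [inner_leviCivitaAux g hX (mdifferentiableAt_add_section hY hY') hZ,
          koszul_add g hX hY hY' hZ, ← inner_leviCivitaAux g hX hY hZ,
          ← inner_leviCivitaAux g hX hY' hZ, add_apply, map_add, add_apply]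
      leibniz {Y f x} hY hf _ := by
        ext v
        refine metric_ext g fun Z hZ ↦ ?_
        obtain ⟨X, hX, rfl⟩ : ∃ X : VF E M, MDiffAt (T% X) x ∧ X x = v :=
          ⟨FiberBundle.extend E v, FiberBundle.mdifferentiableAt_extend .., by simp⟩
        rw [inner_leviCivitaAux g hX (hf.smul_section hY) hZ, koszul_smul g hX hf hY hZ,
          ← inner_leviCivitaAux g hX hY hZ]
        simp }

theorem leviCivita_torsion : (leviCivita g).torsion = 0 := by
  rw [CovariantDerivative.torsion_eq_zero_iff]
  intro X Y x hX hY
  refine metric_ext g fun Z hZ ↦ ?_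
  have h1 : g.inner x (leviCivita g Y x (X x)) (Z x) = _ := inner_leviCivitaAux g hX hY hZ
  have h2 : g.inner x (leviCivita g X x (Y x)) (Z x) = _ := inner_leviCivitaAux g hY hX hZ
  rw [map_sub, sub_apply, h1, h2]
  simp only [koszul, mlieBracket_swap_apply (V := Y) (W := X), map_neg, neg_apply]
  simp only [deriv_inner_comm g (X := Y) (Y := X)]
  ring

/-- A connection `D` on the tangent bundle is metric: `D g = 0`. -/
def IsMetric (D : Connection E M) : Prop :=
  ∀ (X Y : VF E M) (x : M), MDiffAt (T% X) x → MDiffAt (T% Y) x →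
    ∀ v : TangentSpace 𝓘(ℝ, E) x,
      dInner g X Y x v = g.inner x (D X x v) (Y x) + g.inner x (X x) (D Y x v)

theorem leviCivita_isMetric : IsMetric g (leviCivita g) := by
  intro X Y x hX hY v
  obtain ⟨Z, hZ, rfl⟩ : ∃ Z : VF E M, MDiffAt (T% Z) x ∧ Z x = v :=
    ⟨FiberBundle.extend E v, FiberBundle.mdifferentiableAt_extend .., by simp⟩
  have h1 : g.inner x (leviCivita g X x (Z x)) (Y x) = _ := inner_leviCivitaAux g hZ hX hY
  have h2 : g.inner x (leviCivita g Y x (Z x)) (X x) = _ := inner_leviCivitaAux g hZ hY hX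
  rw [g.symm x (X x), h1, h2]
  simp only [koszul, mlieBracket_swap_apply (V := Y) (W := X), map_neg, neg_apply]
  simp only [deriv_inner_comm g (X := Y) (Y := X)]
  ring

/-- The curvature `R(X,Y)Z = D_X D_Y Z - D_Y D_X Z - D_{[X,Y]} Z` of a linear connection. -/
def curvature (D : Connection E M) (X Y Z : VF E M) : VF E M := fun x ↦
  D (fun y ↦ D Z y (Y y)) x (X x) - D (fun y ↦ D Z y (X y)) x (Y x)
    - D Z x (mlieBracket 𝓘(ℝ, E) X Y x)

/-- `(M, g)` is flat: its Riemannian curvature vanishes identically. -/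
def IsFlat : Prop :=
  ∀ X Y Z : VF E M, Smooth X → Smooth Y → Smooth Z → curvature (leviCivita g) X Y Z = 0

/-- The linear connection `∇ + S`, that is, `X, Y ↦ ∇_X Y + S(X)Y`. -/
def ambroseSinger (S : Tensor12 E M) : Connection E M :=
  (leviCivita g).addOneForm (fun x ↦ LinearMap.toContinuousBilinearMap
    (ContinuousLinearMap.coeLM ℝ ∘ₗ (S x).toLinearMap).flip)

theorem ambroseSinger_apply (S : Tensor12 E M) (Y : VF E M) (x : M)
    (v : TangentSpace 𝓘(ℝ, E) x) :
    ambroseSinger g S Y x v = leviCivita g Y x v + S x v (Y x) := rfl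

/-- `S` is a homogeneous Riemannian structure on `(M, g)`: a smooth tensor field of type `(1,2)`
such that `g`, the Riemannian curvature `R` of `g` and `S` are parallel for `∇ + S`. -/
structure IsHomogeneousStructure (S : Tensor12 E M) : Prop where
  smooth : SmoothTensor12 S
  parallel_metric : IsMetric g (ambroseSinger g S)
  parallel_curvature : ∀ W X Y Z : VF E M, Smooth W → Smooth X → Smooth Y → Smooth Z → ∀ x : M,
    ambroseSinger g S (curvature (leviCivita g) X Y Z) x (W x) =
      curvature (leviCivita g) (fun y ↦ ambroseSinger g S X y (W y)) Y Z x
        + curvature (leviCivita g) X (fun y ↦ ambroseSinger g S Y y (W y)) Z x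
        + curvature (leviCivita g) X Y (fun y ↦ ambroseSinger g S Z y (W y)) x
  parallel_self : ∀ W X Y : VF E M, Smooth W → Smooth X → Smooth Y → ∀ x : M,
    ambroseSinger g S (fun y ↦ S y (X y) (Y y)) x (W x) =
      S x (ambroseSinger g S X x (W x)) (Y x) + S x (X x) (ambroseSinger g S Y x (W x))

end Riemannian

section Contact

variable {E : Type*} [NormedAddCommGroup E] [NormedSpace ℝ E] [FiniteDimensional ℝ E]
  {M : Type*} [TopologicalSpace M] [ChartedSpace E M] [IsManifold 𝓘(ℝ, E) ∞ M]

/-- The exterior derivative of a `1`-form, with the convention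
`2 dη(X,Y) = X(η(Y)) - Y(η(X)) - η([X,Y])`. -/
def extDeriv₁ (η : ∀ x : M, TangentSpace 𝓘(ℝ, E) x →L[ℝ] ℝ) (X Y : VF E M) (x : M) : ℝ :=
  (mvfderiv 𝓘(ℝ, E) (fun y ↦ η y (Y y)) x (X x) - mvfderiv 𝓘(ℝ, E) (fun y ↦ η y (X y)) x (Y x)
    - η x (mlieBracket 𝓘(ℝ, E) X Y x)) / 2

/-- A contact Riemannian structure `(φ, ξ, η)` compatible with the metric `g`: an almost contact
structure with `g(φX, φY) = g(X,Y) - η(X)η(Y)` and `dη(X,Y) = g(X, φY)`. In dimension three these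
identities force `dη ∧ η` to vanish nowhere, and `ξ` to be the Reeb vector field of `η`. -/
structure ContactStructure (g : Metric E M) where
  /-- The structure endomorphism field. -/
  φ : Tensor11 E M
  /-- The Reeb vector field. -/
  ξ : VF E M
  /-- The contact form. -/
  η : ∀ x : M, TangentSpace 𝓘(ℝ, E) x →L[ℝ] ℝ
  smooth_φ : SmoothTensor11 φ
  smooth_ξ : Smooth ξ
  smooth_η : SmoothOneForm η
  φ_sq : ∀ (x : M) (X : TangentSpace 𝓘(ℝ, E) x), φ x (φ x X) = -X + η x X • ξ x
  η_ξ : ∀ x : M, η x (ξ x) = 1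
  compatible : ∀ (x : M) (X Y : TangentSpace 𝓘(ℝ, E) x),
    g.inner x (φ x X) (φ x Y) = g.inner x X Y - η x X * η x Y
  contact : ∀ X Y : VF E M, Smooth X → Smooth Y → ∀ x : M,
    extDeriv₁ η X Y x = g.inner x (X x) (φ x (Y x))

namespace ContactStructure

variable {g : Metric E M} (C : ContactStructure g)

/-- `2⁻¹ (£_ξ φ) X = 2⁻¹ ([ξ, φX] - φ[ξ, X])`, for a vector field `X`. -/
def hField (X : VF E M) : VF E M := fun x ↦
  (2⁻¹ : ℝ) • (mlieBracket 𝓘(ℝ, E) C.ξ (fun y ↦ C.φ y (X y)) x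
    - C.φ x (mlieBracket 𝓘(ℝ, E) C.ξ X x))

theorem mdiff_φ {X : VF E M} {x : M} (hX : MDiffAt (T% X) x) :
    MDiffAt (T% (fun y ↦ C.φ y (X y))) x :=
  MDifferentiableAt.clm_bundle_apply (F₁ := E) (F₂ := E) (b := fun y : M ↦ y)
    (C.smooth_φ.mdifferentiable (by simp) x) hX

theorem hField_tensorial (x : M) : TensorialAt 𝓘(ℝ, E) E (fun X ↦ C.hField X x) x where
  smul {f X} hf hX := by
    have e : (fun y ↦ C.φ y ((f • X) y)) = f • fun y ↦ C.φ y (X y) := by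
      funext y
      simp
    simp only [hField, e, mlieBracket_smul_right hf (C.mdiff_φ hX), mlieBracket_smul_right hf hX,
      map_add, map_smul]
    module
  add {X Y} hX hY := by
    have e : (fun y ↦ C.φ y ((X + Y) y)) = (fun y ↦ C.φ y (X y)) + fun y ↦ C.φ y (Y y) := by
      funext y
      simp
    simp only [hField, e, mlieBracket_add_right (C.mdiff_φ hX) (C.mdiff_φ hY),
      mlieBracket_add_right hX hY, map_add]
    module

/-- The tensor field `h = £_ξ φ / 2`. -/
def h : Tensor11 E M := fun x ↦ TensorialAt.mkHom (fun X ↦ C.hField X x) x (C.hField_tensorial x)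

theorem h_apply {X : VF E M} {x : M} (hX : MDiffAt (T% X) x) : C.h x (X x) = C.hField X x :=
  TensorialAt.mkHom_apply (C.hField_tensorial x) hX

/-- `φ(I + h)`. -/
def φh : Tensor11 E M := fun x ↦ C.φ x ∘L (ContinuousLinearMap.id ℝ _ + C.h x)

/-- Sasakian: `(∇_X φ)Y = g(X,Y)ξ - η(Y)X`. -/
def IsSasakian : Prop :=
  ∀ X Y : VF E M, Smooth X → Smooth Y → ∀ x : M,
    leviCivita g (fun y ↦ C.φ y (Y y)) x (X x) - C.φ x (leviCivita g Y x (X x)) =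
      g.inner x (X x) (Y x) • C.ξ x - C.η x (Y x) • X x

/-- Contact `(κ, μ)`-space: `R(X,Y)ξ = (κ I + μ h)(η(Y)X - η(X)Y)`. -/
def IsKappaMu (κ μ : ℝ) : Prop :=
  ∀ X Y : VF E M, Smooth X → Smooth Y → ∀ x : M,
    curvature (leviCivita g) X Y C.ξ x =
      κ • (C.η x (Y x) • X x - C.η x (X x) • Y x)
        + μ • C.h x (C.η x (Y x) • X x - C.η x (X x) • Y x)

/-- Boeckx's tensor field
`S(X)Y = -g(φ(I + h)X, Y)ξ + (μ/2) η(X) φY + η(Y) φ(I + h)X`. -/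
def boeckx (μ : ℝ) : Tensor12 E M := fun x ↦ LinearMap.toContinuousLinearMap
  { toFun := fun X ↦ -(g.inner x (C.φh x X)).smulRight (C.ξ x) + (μ / 2 * C.η x X) • C.φ x
      + (C.η x).smulRight (C.φh x X)
    map_add' := fun X Y ↦ by
      ext Z
      simp
      module
    map_smul' := fun a X ↦ by
      ext Z
      simp
      module }

theorem boeckx_apply (μ : ℝ) (x : M) (X Y : TangentSpace 𝓘(ℝ, E) x) :
    C.boeckx μ x X Y = -(g.inner x (C.φh x X) Y • C.ξ x) + (μ / 2 * C.η x X) • C.φ x Y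
      + C.η x Y • C.φh x X := rfl

/-- On the open set `U`, the vector fields `e 0, e 1, e 2` are the left invariant frame of a local
Lie group structure with unimodular Lie algebra
`[e 0, e 1] = c₃ e 2`, `[e 1, e 2] = 2 e 0`, `[e 2, e 0] = c₂ e 1`,
they are orthonormal, and `ξ = e 0`, `φ(e 1) = e 2`, `φ(e 2) = - e 1`. -/
structure IsUnimodularFrameOn (U : Set M) (e : Fin 3 → VF E M) (c₂ c₃ : ℝ) : Prop where
  smooth : ∀ i, SmoothOn (e i) U
  orthonormal : ∀ x ∈ U, ∀ i j, g.inner x (e i x) (e j x) = if i = j then 1 else 0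
  ξ_eq : ∀ x ∈ U, C.ξ x = e 0 x
  φ_one : ∀ x ∈ U, C.φ x (e 1 x) = e 2 x
  φ_two : ∀ x ∈ U, C.φ x (e 2 x) = -e 1 x
  bracket_zero_one : ∀ x ∈ U, mlieBracket 𝓘(ℝ, E) (e 0) (e 1) x = c₃ • e 2 x
  bracket_one_two : ∀ x ∈ U, mlieBracket 𝓘(ℝ, E) (e 1) (e 2) x = (2 : ℝ) • e 0 x
  bracket_two_zero : ∀ x ∈ U, mlieBracket 𝓘(ℝ, E) (e 2) (e 0) x = c₂ • e 1 x

end ContactStructure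

end Contact

section LieGroups

variable {E : Type*} [NormedAddCommGroup E] [NormedSpace ℝ E] [FiniteDimensional ℝ E]
  {M : Type*} [TopologicalSpace M] [ChartedSpace E M] [IsManifold 𝓘(ℝ, E) ∞ M]
  {G : Type*} [TopologicalSpace G] [ChartedSpace E G] [Group G] [LieGroup 𝓘(ℝ, E) ∞ G]

/-- A contact Riemannian structure on a Lie group all of whose structure tensor fields
`(g, φ, ξ, η)` are left invariant. -/
structure IsLeftInvariant {g : Metric E G} (C : ContactStructure g) : Prop where
  metric : ∀ (v w : GroupLieAlgebra 𝓘(ℝ, E) G) (a : G),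
    g.inner a (mulInvariantVectorField v a) (mulInvariantVectorField w a) = g.inner 1 v w
  φ : ∀ (v : GroupLieAlgebra 𝓘(ℝ, E) G) (a : G),
    C.φ a (mulInvariantVectorField v a) = mulInvariantVectorField (C.φ 1 v) a
  ξ : ∀ a : G, C.ξ a = mulInvariantVectorField (C.ξ 1) a
  η : ∀ (v : GroupLieAlgebra 𝓘(ℝ, E) G) (a : G), C.η a (mulInvariantVectorField v a) = C.η 1 v

/-- On `U`, the smooth map `f : M → G` is an isomorphism onto its image, locally, of contact
Riemannian manifolds: it preserves `(g, φ, ξ, η)`. (Source and target have the same dimension, so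
preservation of the metric makes `f` a local diffeomorphism.) -/
structure IsLocalIsomorphismOn {g : Metric E M} (C : ContactStructure g) {g' : Metric E G}
    (C' : ContactStructure g') (f : M → G) (U : Set M) : Prop where
  smooth : ContMDiffOn 𝓘(ℝ, E) 𝓘(ℝ, E) ∞ f U
  metric : ∀ x ∈ U, ∀ X Y : TangentSpace 𝓘(ℝ, E) x,
    g'.inner (f x) (mfderiv 𝓘(ℝ, E) 𝓘(ℝ, E) f x X) (mfderiv 𝓘(ℝ, E) 𝓘(ℝ, E) f x Y)
      = g.inner x X Y
  φ : ∀ x ∈ U, ∀ X : TangentSpace 𝓘(ℝ, E) x,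
    C'.φ (f x) (mfderiv 𝓘(ℝ, E) 𝓘(ℝ, E) f x X) = mfderiv 𝓘(ℝ, E) 𝓘(ℝ, E) f x (C.φ x X)
  ξ : ∀ x ∈ U, mfderiv 𝓘(ℝ, E) 𝓘(ℝ, E) f x (C.ξ x) = C'.ξ (f x)
  η : ∀ x ∈ U, ∀ X : TangentSpace 𝓘(ℝ, E) x,
    C'.η (f x) (mfderiv 𝓘(ℝ, E) 𝓘(ℝ, E) f x X) = C.η x X

/-- On `U`, the tensor field `S` on `M` corresponds under `f : M → G` to `∇⁽⁻⁾ - ∇`, where `∇⁽⁻⁾`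
is the Cartan-Schouten `(-)`-connection of the Lie group `G`. As `∇⁽⁻⁾ V = 0` for the left invariant
vector fields `V`, the value of `∇⁽⁻⁾ - ∇` on `(X, V)` is `-∇_X V`. -/
def CorrespondsToMinusOn (S : Tensor12 E M) (g' : Metric E G) (f : M → G) (U : Set M) : Prop :=
  ∀ x ∈ U, ∀ (X Y : TangentSpace 𝓘(ℝ, E) x) (v : GroupLieAlgebra 𝓘(ℝ, E) G),
    mfderiv 𝓘(ℝ, E) 𝓘(ℝ, E) f x Y = mulInvariantVectorField v (f x) →
    mfderiv 𝓘(ℝ, E) 𝓘(ℝ, E) f x (S x X Y) =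
      -(leviCivita g' (mulInvariantVectorField v) (f x) (mfderiv 𝓘(ℝ, E) 𝓘(ℝ, E) f x X))

end LieGroups

end ContactKM

end

/-!
# Boeckx's homogeneous structure on a contact `(κ, μ)`-space

Everything happens in an orthonormal frame `e 0 = ξ`, `e 1`, `e 2 = φ (e 1)`. The contact condition
gives the `ξ`-components of the brackets `[e i, e j]` and, by the Jacobi identity, one further
relation between their components, so five structure functions remain: the components `α`, `β` of
`h`, and the components `a`, `b`, `c` of `∇ (e 1)` along `e 2` (`IsAdaptedFrameWith`). Comparing the
curvature with the `(κ, μ)`-condition gives `κ = 1 - α² - β²` (`kappa_eq`). If `κ = 1`, then `h = 0`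
and the space is Sasakian. Otherwise `κ = 1 - l²` with `l > 0`, and near each point `e 1` can be
chosen as an eigenvector of `h` for the eigenvalue `l`; the `(κ, μ)`-condition then forces
`a = -μ / 2` and `b = c = 0` (`IsKappaMu.exists_eigenframe`). Hence such an *eigenframe* has constant
structure functions: it is the left invariant frame of a local Lie group with structure constants
`2`, `1 - l - μ / 2`, `1 + l - μ / 2`.

Boeckx's tensor field `S` is built from `φ`, `h` and `η`, and evaluating it on an eigenframe gives
`S (e i) (e j) = -∇_{e i} (e j)`. So an eigenframe is parallel for the metric connection `∇ + S`,
and tensor fields with constant components in it are parallel. The curvature and `S` itself are such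
tensor fields, and `S` is therefore a homogeneous structure
(`isHomogeneousStructure_of_parallel_frame`).

Under a local isomorphism `f` into a Lie group with left invariant contact structure, `h` preserves
the pullbacks of the left invariant fields, so that these contain an eigenframe. Their constant
combinations are thus parallel for `∇ + S`, which says that `S` corresponds to `∇⁽⁻⁾ - ∇`
(`IsLocalIsomorphismOn.correspondsToMinus`).

For uniqueness, let `S'` be a homogeneous structure and `τ` the connection form of `∇ + S'` in an
eigenframe. Parallelism of the curvature says `(ρ_i - ρ_j) τ_{ij} = 0` for the eigenvalues
`2 (1 - l²)`, `-μ (1 - l)`, `-μ (1 + l)` of the Ricci tensor. Outside the excluded case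
`(2 + μ)² = 4 l²`, two eigenvalues can coincide only if `μ = 0` or `l = 1`, and then one component
of the equation `(∇ + S') S' = 0` eliminates the remaining part of `τ`. So the eigenframe is parallel
for `∇ + S'`, and `S' = S` (`IsKappaMu.homogeneousStructure_unique`).
-/

set_option linter.unusedSectionVars false

namespace ContactKM

open Filter Topology

/-! ### Smooth functions and vector fields on open sets -/

section Calculus

variable {E : Type*} [NormedAddCommGroup E] [NormedSpace ℝ E]
  {M : Type*} [TopologicalSpace M] [ChartedSpace E M] [IsManifold 𝓘(ℝ, E) ∞ M]

/-- The real function `f` is smooth on the set `U`. -/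
def SmoothFunOn (E : Type*) [NormedAddCommGroup E] [NormedSpace ℝ E]
    {M : Type*} [TopologicalSpace M] [ChartedSpace E M] (f : M → ℝ) (U : Set M) : Prop :=
  ContMDiffOn 𝓘(ℝ, E) 𝓘(ℝ, ℝ) ∞ f U

instance isManifold_minSmoothness_three : IsManifold 𝓘(ℝ, E) (minSmoothness ℝ 3) M :=
  IsManifold.of_le (n := ∞) (by
    rw [minSmoothness_of_isRCLikeNormedField]; exact WithTop.coe_le_coe.2 (le_top : (3 : ℕ∞) ≤ ⊤))

variable {X Y Z : VF E M} {f f' : M → ℝ} {U V : Set M} {x : M}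

theorem SmoothFunOn.mdiffAt (hf : SmoothFunOn E f U) (hU : IsOpen U) (hx : x ∈ U) :
    MDiffAt f x :=
  (hf.contMDiffAt (hU.mem_nhds hx)).mdifferentiableAt (by simp)

theorem SmoothFunOn.mono (hf : SmoothFunOn E f U) (h : V ⊆ U) : SmoothFunOn E f V :=
  ContMDiffOn.mono hf h

theorem SmoothFunOn.congr (hf : SmoothFunOn E f U) (h : ∀ y ∈ U, f' y = f y) :
    SmoothFunOn E f' U :=
  ContMDiffOn.congr hf h

theorem SmoothFunOn.add (hf : SmoothFunOn E f U) (hf' : SmoothFunOn E f' U) :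
    SmoothFunOn E (fun y ↦ f y + f' y) U :=
  ContMDiffOn.add hf hf'

theorem SmoothFunOn.sub (hf : SmoothFunOn E f U) (hf' : SmoothFunOn E f' U) :
    SmoothFunOn E (fun y ↦ f y - f' y) U :=
  ContMDiffOn.sub hf hf'

theorem SmoothFunOn.mul (hf : SmoothFunOn E f U) (hf' : SmoothFunOn E f' U) :
    SmoothFunOn E (fun y ↦ f y * f' y) U :=
  ContMDiffOn.mul hf hf'

theorem SmoothFunOn.const (c : ℝ) : SmoothFunOn E (fun _ : M ↦ c) U :=
  contMDiffOn_const

theorem SmoothFunOn.comp {φ : ℝ → ℝ} (hf : SmoothFunOn E f U)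
    (hφ : ∀ y ∈ U, ContDiffAt ℝ ∞ φ (f y)) : SmoothFunOn E (fun y ↦ φ (f y)) U :=
  fun y hy ↦ (hφ y hy).contMDiffAt.comp_contMDiffWithinAt y (hf y hy)

theorem SmoothOn.mdiffAt (hX : SmoothOn X U) (hU : IsOpen U) (hx : x ∈ U) : MDiffAt (T% X) x :=
  (hX.contMDiffAt (hU.mem_nhds hx)).mdifferentiableAt (by simp)

theorem Smooth.smoothOn (hX : Smooth X) (U : Set M) : SmoothOn X U := ContMDiff.contMDiffOn hX

theorem Smooth.mdiffAt (hX : Smooth X) (x : M) : MDiffAt (T% X) x :=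
  (hX x).mdifferentiableAt (by simp)

theorem SmoothOn.mono (hX : SmoothOn X U) (h : V ⊆ U) : SmoothOn X V := ContMDiffOn.mono hX h

theorem SmoothOn.congr (hX : SmoothOn X U) (h : ∀ y ∈ U, Y y = X y) : SmoothOn Y U :=
  ContMDiffOn.congr hX fun y hy ↦ by simp [h y hy]

theorem SmoothOn.add (hX : SmoothOn X U) (hY : SmoothOn Y U) :
    SmoothOn (fun y ↦ X y + Y y) U := ContMDiffOn.add_section hX hY

theorem SmoothOn.sub (hX : SmoothOn X U) (hY : SmoothOn Y U) :
    SmoothOn (fun y ↦ X y - Y y) U := ContMDiffOn.sub_section hX hY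

theorem SmoothOn.neg (hX : SmoothOn X U) : SmoothOn (fun y ↦ -X y) U :=
  ContMDiffOn.neg_section hX

theorem SmoothOn.smul (hf : SmoothFunOn E f U) (hX : SmoothOn X U) :
    SmoothOn (fun y ↦ f y • X y) U := ContMDiffOn.smul_section hf hX

theorem SmoothOn.const_smul (c : ℝ) (hX : SmoothOn X U) :
    SmoothOn (fun y ↦ c • X y) U := SmoothOn.smul (.const c) hX

theorem SmoothOn.sum {ι : Type*} {s : Finset ι} {t : ι → VF E M} (h : ∀ i ∈ s, SmoothOn (t i) U) :
    SmoothOn (fun y ↦ ∑ i ∈ s, t i y) U := ContMDiffOn.sum_section h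

/-- A vector field that is smooth near a point agrees near that point with a globally smooth one. -/
theorem SmoothOn.exists_smooth_extension [FiniteDimensional ℝ E] [T2Space M]
    (hX : SmoothOn X U) (hU : IsOpen U) (hx : x ∈ U) :
    ∃ X' : VF E M, Smooth X' ∧ ∃ V ⊆ U, IsOpen V ∧ x ∈ V ∧ ∀ y ∈ V, X' y = X y := by
  obtain ⟨ψ, -, hψ⟩ := (SmoothBumpFunction.nhds_basis_tsupport (I := 𝓘(ℝ, E)) x).mem_iff.1
    (hU.mem_nhds hx)
  have h : Smooth (fun y ↦ ψ y • X y) :=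
    ContMDiffOn.smul_section_of_tsupport (ψ.contMDiff.contMDiffOn) hU hψ hX
  obtain ⟨V, hV, hVo, hxV⟩ := eventually_nhds_iff.1 (ψ.eventuallyEq_one)
  exact ⟨_, h, V ∩ U, Set.inter_subset_right, hVo.inter hU, ⟨hxV, hx⟩, fun y hy ↦ by
    simp [hV y hy.1]⟩

variable [FiniteDimensional ℝ E]

theorem SmoothOn.inner (g : Metric E M) (hX : SmoothOn X U) (hY : SmoothOn Y U) :
    SmoothFunOn E (fun y ↦ g.inner y (X y) (Y y)) U := by
  intro x hx
  have := ContMDiffWithinAt.clm_bundle_apply₂ (F₁ := E) (F₂ := E) (F₃ := ℝ)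
    (E₃ := Bundle.Trivial M ℝ) (b := fun y : M ↦ y) (g.contMDiff.contMDiffOn x hx) (hX x hx)
    (hY x hx)
  simp only [contMDiffWithinAt_totalSpace] at this
  exact this.2

theorem SmoothOn.mlieBracket (hU : IsOpen U) (hX : SmoothOn X U) (hY : SmoothOn Y U) :
    SmoothOn (mlieBracket 𝓘(ℝ, E) X Y) U := by
  intro x hx
  have : IsManifold 𝓘(ℝ, E) (((⊤ : ℕ∞) : WithTop ℕ∞) + 1) M :=
    inferInstanceAs (IsManifold 𝓘(ℝ, E) ∞ M)
  exact (ContMDiffAt.mlieBracket_vectorField (m := ⊤) (n := ⊤) (hX.contMDiffAt (hU.mem_nhds hx))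
    (hY.contMDiffAt (hU.mem_nhds hx)) (by
      rw [minSmoothness_of_isRCLikeNormedField]; rfl)).contMDiffWithinAt

theorem SmoothTensor11.apply {φ : Tensor11 E M} (hφ : SmoothTensor11 φ) (hX : SmoothOn X U) :
    SmoothOn (fun y ↦ φ y (X y)) U :=
  ContMDiffOn.clm_bundle_apply (F₁ := E) (F₂ := E) (b := fun y : M ↦ y) hφ.contMDiffOn hX

theorem SmoothTensor12.apply {S : Tensor12 E M} (hS : SmoothTensor12 S) (hX : SmoothOn X U)
    (hY : SmoothOn Y U) : SmoothOn (fun y ↦ S y (X y) (Y y)) U :=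
  ContMDiffOn.clm_bundle_apply₂ (F₁ := E) (F₂ := E) (F₃ := E) (b := fun y : M ↦ y)
    hS.contMDiffOn hX hY

theorem SmoothOneForm.apply {η : ∀ x : M, TangentSpace 𝓘(ℝ, E) x →L[ℝ] ℝ} (hη : SmoothOneForm η)
    (hX : SmoothOn X U) : SmoothFunOn E (fun y ↦ η y (X y)) U := by
  intro x hx
  have := ContMDiffWithinAt.clm_bundle_apply (F₁ := E) (F₂ := ℝ)
    (E₂ := Bundle.Trivial M ℝ) (b := fun y : M ↦ y) (hη.contMDiffOn x hx) (hX x hx)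
  simp only [contMDiffWithinAt_totalSpace] at this
  exact this.2

/-- The derivative of a smooth function along a smooth vector field is smooth. -/
theorem SmoothFunOn.deriv (hU : IsOpen U) (hf : SmoothFunOn E f U) (hX : SmoothOn X U) :
    SmoothFunOn E (fun y ↦ mvfderiv 𝓘(ℝ, E) f y (X y)) U := by
  have h1 : ContMDiffOn 𝓘(ℝ, E).tangent 𝓘(ℝ, ℝ).tangent ∞ (tangentMapWithin 𝓘(ℝ, E) 𝓘(ℝ, ℝ) f U)
      (TotalSpace.proj ⁻¹' U) :=
    ContMDiffOn.contMDiffOn_tangentMapWithin hf (by simp) hU.uniqueMDiffOn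
  have h2 : ContMDiffOn 𝓘(ℝ, E) 𝓘(ℝ, ℝ).tangent ∞ (fun y ↦ tangentMapWithin 𝓘(ℝ, E) 𝓘(ℝ, ℝ) f U
      (TotalSpace.mk' E (E := fun x : M ↦ TangentSpace 𝓘(ℝ, E) x) y (X y))) U :=
    h1.comp hX fun y hy ↦ hy
  have h3 := (contMDiff_snd_tangentBundle_modelSpace ℝ 𝓘(ℝ, ℝ) (n := ∞)).comp_contMDiffOn h2
  refine ContMDiffOn.congr h3 fun y hy ↦ ?_
  simp only [Function.comp, tangentMapWithin, mfderivWithin_of_isOpen hU hy]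
  rfl

/-- Every tangent vector extends to a vector field that is smooth on a neighbourhood. -/
theorem exists_smoothOn_extend (v : TangentSpace 𝓘(ℝ, E) x) :
    ∃ (U : Set M) (X : VF E M), IsOpen U ∧ x ∈ U ∧ SmoothOn X U ∧ X x = v := by
  obtain ⟨s, hs, h⟩ := FiberBundle.exists_contMDiffOn_extend (k := ∞) 𝓘(ℝ, E) E v
  obtain ⟨U, hUs, hU, hx⟩ := mem_nhds_iff.1 hs
  exact ⟨U, _, hU, hx, ContMDiffOn.mono h hUs, by simp⟩

/-! ### Locality and Leibniz rules -/

theorem mvfderiv_congr (hU : IsOpen U) (hx : x ∈ U) (h : ∀ y ∈ U, f y = f' y) :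
    mvfderiv 𝓘(ℝ, E) f x = mvfderiv 𝓘(ℝ, E) f' x := by
  have : f =ᶠ[𝓝 x] f' := eventually_of_mem (hU.mem_nhds hx) h
  unfold mvfderiv
  rw [this.mfderiv_eq, this.eq_of_nhds]

theorem mlieBracket_congr {X' Y' : VF E M} (hU : IsOpen U) (hx : x ∈ U)
    (hX : ∀ y ∈ U, X y = X' y) (hY : ∀ y ∈ U, Y y = Y' y) :
    mlieBracket 𝓘(ℝ, E) X Y x = mlieBracket 𝓘(ℝ, E) X' Y' x :=
  Filter.EventuallyEq.mlieBracket_vectorField_eq (eventually_of_mem (hU.mem_nhds hx) hX)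
    (eventually_of_mem (hU.mem_nhds hx) hY)

theorem mdiffAt_congr (hU : IsOpen U) (hx : x ∈ U) (h : ∀ y ∈ U, Y y = X y)
    (hX : MDiffAt (T% X) x) : MDiffAt (T% Y) x :=
  hX.congr_of_eventuallyEq (eventually_of_mem (hU.mem_nhds hx) fun y hy ↦ by simp [h y hy])

namespace Connection

variable (D : Connection E M) (v : TangentSpace 𝓘(ℝ, E) x)

protected theorem congr (hU : IsOpen U) (hx : x ∈ U) (h : ∀ y ∈ U, Y y = X y)
    (hX : MDiffAt (T% X) x) : D Y x = D X x :=
  D.isCovariantDerivativeOnUniv.congr_of_eventuallyEq (mdiffAt_congr hU hx h hX) hX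
    Filter.univ_mem (eventually_of_mem (hU.mem_nhds hx) h)

theorem add_section (hX : MDiffAt (T% X) x) (hY : MDiffAt (T% Y) x) :
    D (fun y ↦ X y + Y y) x v = D X x v + D Y x v := by
  have := D.isCovariantDerivativeOnUniv.add hX hY
  exact congrArg (fun L ↦ L v) this

theorem smul_section (hf : MDiffAt f x) (hX : MDiffAt (T% X) x) :
    D (fun y ↦ f y • X y) x v = f x • D X x v + mvfderiv 𝓘(ℝ, E) f x v • X x := by
  have := D.isCovariantDerivativeOnUniv.leibniz hX hf
  exact congrArg (fun L ↦ L v) this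

theorem const_smul_section (c : ℝ) (hX : MDiffAt (T% X) x) :
    D (fun y ↦ c • X y) x v = c • D X x v := by
  rw [smul_section (f := fun _ ↦ c) D v mdifferentiableAt_const hX,
    mvfderiv_const]
  simp

theorem neg_section (hX : MDiffAt (T% X) x) : D (fun y ↦ -X y) x v = -D X x v := by
  simpa using const_smul_section D v (-1) hX

theorem sub_section (hX : MDiffAt (T% X) x) (hY : MDiffAt (T% Y) x) :
    D (fun y ↦ X y - Y y) x v = D X x v - D Y x v := by
  simp only [sub_eq_add_neg]
  rw [add_section D v hX (Y := fun y ↦ -Y y) (mdifferentiableAt_neg_section hY),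
    neg_section D v hY]

theorem zero_section : D (fun _ ↦ 0) x v = 0 := by
  have := D.zero
  exact congrArg (fun L ↦ L x v) this

theorem sum_section {ι : Type*} (s : Finset ι) {t : ι → VF E M}
    (h : ∀ i ∈ s, MDiffAt (T% (t i)) x) :
    D (fun y ↦ ∑ i ∈ s, t i y) x v = ∑ i ∈ s, D (t i) x v := by
  classical
  induction s using Finset.induction_on with
  | empty => simpa using zero_section D v
  | insert a s ha ih =>
    simp only [Finset.sum_insert ha]
    rw [add_section D v (h a (by simp))
      (.sum_section fun i hi ↦ h i (by simp [hi])), ih fun i hi ↦ h i (by simp [hi])]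

end Connection

theorem mlieBracket_smul_section_right (hf : MDiffAt f x) (hY : MDiffAt (T% Y) x) :
    mlieBracket 𝓘(ℝ, E) X (fun y ↦ f y • Y y) x =
      mvfderiv 𝓘(ℝ, E) f x (X x) • Y x + f x • mlieBracket 𝓘(ℝ, E) X Y x := by
  exact mlieBracket_smul_right hf hY

theorem mlieBracket_smul_section_left (hf : MDiffAt f x) (hX : MDiffAt (T% X) x) :
    mlieBracket 𝓘(ℝ, E) (fun y ↦ f y • X y) Y x =
      -mvfderiv 𝓘(ℝ, E) f x (Y x) • X x + f x • mlieBracket 𝓘(ℝ, E) X Y x := by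
  exact mlieBracket_smul_left (W := Y) hf hX

theorem mlieBracket_add_section_right {Y' : VF E M} (hY : MDiffAt (T% Y) x)
    (hY' : MDiffAt (T% Y') x) :
    mlieBracket 𝓘(ℝ, E) X (fun y ↦ Y y + Y' y) x =
      mlieBracket 𝓘(ℝ, E) X Y x + mlieBracket 𝓘(ℝ, E) X Y' x :=
  mlieBracket_add_right hY hY'

theorem mlieBracket_add_section_left {X' : VF E M} (hX : MDiffAt (T% X) x)
    (hX' : MDiffAt (T% X') x) :
    mlieBracket 𝓘(ℝ, E) (fun y ↦ X y + X' y) Y x =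
      mlieBracket 𝓘(ℝ, E) X Y x + mlieBracket 𝓘(ℝ, E) X' Y x :=
  mlieBracket_add_left hX hX'

theorem jacobi (hU : IsOpen U) (hx : x ∈ U) (hX : SmoothOn X U) (hY : SmoothOn Y U)
    (hZ : SmoothOn Z U) :
    mlieBracket 𝓘(ℝ, E) X (mlieBracket 𝓘(ℝ, E) Y Z) x =
      mlieBracket 𝓘(ℝ, E) (mlieBracket 𝓘(ℝ, E) X Y) Z x
        + mlieBracket 𝓘(ℝ, E) Y (mlieBracket 𝓘(ℝ, E) X Z) x := by
  have h2 : minSmoothness ℝ 2 ≤ ∞ := by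
    rw [minSmoothness_of_isRCLikeNormedField]; exact WithTop.coe_le_coe.2 (le_top : (2 : ℕ∞) ≤ ⊤)
  exact leibniz_identity_mlieBracket_apply ((hX.contMDiffAt (hU.mem_nhds hx)).of_le h2)
    ((hY.contMDiffAt (hU.mem_nhds hx)).of_le h2) ((hZ.contMDiffAt (hU.mem_nhds hx)).of_le h2)

/-- `[X,Y] f = X (Y f) - Y (X f)`. Expanding the Jacobi identity for `X`, `Y` and `f Z`, where `Z`
does not vanish at the given point, leaves exactly this identity multiplied by `Z`. -/
theorem mvfderiv_mlieBracket (hU : IsOpen U) (hx : x ∈ U) (hf : SmoothFunOn E f U)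
    (hX : SmoothOn X U) (hY : SmoothOn Y U) :
    mvfderiv 𝓘(ℝ, E) f x (mlieBracket 𝓘(ℝ, E) X Y x) =
      mvfderiv 𝓘(ℝ, E) (fun y ↦ mvfderiv 𝓘(ℝ, E) f y (Y y)) x (X x)
        - mvfderiv 𝓘(ℝ, E) (fun y ↦ mvfderiv 𝓘(ℝ, E) f y (X y)) x (Y x) := by
  by_cases hv : ∃ v : TangentSpace 𝓘(ℝ, E) x, v ≠ 0
  · obtain ⟨v, hv⟩ := hv
    obtain ⟨V, Z, hV, hxV, hZ, rfl⟩ := exists_smoothOn_extend v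
    have hW : IsOpen (U ∩ V) := hU.inter hV
    have hxW : x ∈ U ∩ V := ⟨hx, hxV⟩
    replace hf := hf.mono (V := U ∩ V) Set.inter_subset_left
    replace hX := hX.mono (V := U ∩ V) Set.inter_subset_left
    replace hY := hY.mono (V := U ∩ V) Set.inter_subset_left
    replace hZ := hZ.mono (V := U ∩ V) Set.inter_subset_right
    have hXf := hf.deriv hW hX
    have hYf := hf.deriv hW hY
    have hXY := hX.mlieBracket hW hY
    have hXZ := hX.mlieBracket hW hZ
    have hYZ := hY.mlieBracket hW hZ
    have h := jacobi hW hxW hX hY (hZ.smul hf)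
    have h0 := jacobi hW hxW hX hY hZ
    have e1 : ∀ y ∈ U ∩ V, mlieBracket 𝓘(ℝ, E) X (fun y ↦ f y • Z y) y =
        mvfderiv 𝓘(ℝ, E) f y (X y) • Z y + f y • mlieBracket 𝓘(ℝ, E) X Z y := fun y hy ↦
      mlieBracket_smul_section_right (hf.mdiffAt hW hy) (hZ.mdiffAt hW hy)
    have e2 : ∀ y ∈ U ∩ V, mlieBracket 𝓘(ℝ, E) Y (fun y ↦ f y • Z y) y =
        mvfderiv 𝓘(ℝ, E) f y (Y y) • Z y + f y • mlieBracket 𝓘(ℝ, E) Y Z y := fun y hy ↦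
      mlieBracket_smul_section_right (hf.mdiffAt hW hy) (hZ.mdiffAt hW hy)
    rw [mlieBracket_congr hW hxW (fun _ _ ↦ rfl) e2, mlieBracket_congr (X := Y) hW hxW
      (fun _ _ ↦ rfl) e1, mlieBracket_smul_section_right (hf.mdiffAt hW hxW) (hZ.mdiffAt hW hxW),
      mlieBracket_add_section_right ((hZ.smul hYf).mdiffAt hW hxW)
        ((hYZ.smul hf).mdiffAt hW hxW),
      mlieBracket_add_section_right ((hZ.smul hXf).mdiffAt hW hxW)
        ((hXZ.smul hf).mdiffAt hW hxW),
      mlieBracket_smul_section_right (hYf.mdiffAt hW hxW) (hZ.mdiffAt hW hxW),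
      mlieBracket_smul_section_right (hXf.mdiffAt hW hxW) (hZ.mdiffAt hW hxW),
      mlieBracket_smul_section_right (hf.mdiffAt hW hxW) (hYZ.mdiffAt hW hxW),
      mlieBracket_smul_section_right (hf.mdiffAt hW hxW) (hXZ.mdiffAt hW hxW), h0] at h
    refine smul_left_injective ℝ hv ?_
    simp only
    refine sub_eq_zero.1 (Eq.trans ?_ (neg_eq_zero.2 (sub_eq_zero.2 h)))
    module
  · push Not at hv
    simp [hv]

/-! ### Tensoriality of the curvature -/

/-- The connection `D` is smooth on `U`: for fields `X`, `Y` that are smooth on an open subset of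
`U`, so is `D_X Y`. -/
def IsSmoothConnectionOn (D : Connection E M) (U : Set M) : Prop :=
  ∀ V ⊆ U, IsOpen V → ∀ X Y : VF E M, SmoothOn X V → SmoothOn Y V →
    SmoothOn (fun y ↦ D Y y (X y)) V

variable {D : Connection E M}

theorem IsSmoothConnectionOn.mono (hD : IsSmoothConnectionOn D U) (h : V ⊆ U) :
    IsSmoothConnectionOn D V :=
  fun W hW ↦ hD W (hW.trans h)

theorem curvature_congr {X' Y' Z' : VF E M} (hD : IsSmoothConnectionOn D U) (hU : IsOpen U)
    (hx : x ∈ U) (hX : SmoothOn X U) (hY : SmoothOn Y U) (hZ : SmoothOn Z U)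
    (eX : ∀ y ∈ U, X' y = X y) (eY : ∀ y ∈ U, Y' y = Y y) (eZ : ∀ y ∈ U, Z' y = Z y) :
    curvature D X' Y' Z' x = curvature D X Y Z x := by
  have e : ∀ y ∈ U, D Z' y = D Z y := fun y hy ↦
    Connection.congr D hU hy eZ (hZ.mdiffAt hU hy)
  have h1 : D (fun y ↦ D Z' y (Y' y)) x = D (fun y ↦ D Z y (Y y)) x :=
    Connection.congr D hU hx (fun y hy ↦ by rw [e y hy, eY y hy])
      ((hD U subset_rfl hU Y Z hY hZ).mdiffAt hU hx)
  have h2 : D (fun y ↦ D Z' y (X' y)) x = D (fun y ↦ D Z y (X y)) x :=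
    Connection.congr D hU hx (fun y hy ↦ by rw [e y hy, eX y hy])
      ((hD U subset_rfl hU X Z hX hZ).mdiffAt hU hx)
  unfold curvature
  rw [h1, h2, e x hx, mlieBracket_congr hU hx eX eY, eX x hx, eY x hx]

theorem curvature_swap (X Y Z : VF E M) (x : M) :
    curvature D X Y Z x = -curvature D Y X Z x := by
  unfold curvature
  rw [mlieBracket_swap_apply, map_neg]
  abel

theorem curvature_smul_left (hD : IsSmoothConnectionOn D U) (hU : IsOpen U)
    (hx : x ∈ U) (hf : SmoothFunOn E f U) (hX : SmoothOn X U) (hZ : SmoothOn Z U) :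
    curvature D (fun y ↦ f y • X y) Y Z x = f x • curvature D X Y Z x := by
  have hXZ := hD U subset_rfl hU X Z hX hZ
  unfold curvature
  simp only [map_smul]
  rw [Connection.smul_section D _ (hf.mdiffAt hU hx) (hXZ.mdiffAt hU hx),
    mlieBracket_smul_section_left (hf.mdiffAt hU hx) (hX.mdiffAt hU hx)]
  simp only [map_add, map_smul]
  module

theorem curvature_add_left {X' : VF E M} (hD : IsSmoothConnectionOn D U) (hU : IsOpen U)
    (hx : x ∈ U) (hX : SmoothOn X U) (hX' : SmoothOn X' U) (hZ : SmoothOn Z U) :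
    curvature D (fun y ↦ X y + X' y) Y Z x = curvature D X Y Z x + curvature D X' Y Z x := by
  have hXZ := hD U subset_rfl hU X Z hX hZ
  have hXZ' := hD U subset_rfl hU X' Z hX' hZ
  unfold curvature
  simp only [map_add]
  rw [Connection.add_section D _ (hXZ.mdiffAt hU hx) (hXZ'.mdiffAt hU hx),
    mlieBracket_add_section_left (hX.mdiffAt hU hx) (hX'.mdiffAt hU hx)]
  simp only [map_add]
  abel

/-- The second derivatives of `f` cancel by `mvfderiv_mlieBracket`. -/
theorem curvature_smul_right (hD : IsSmoothConnectionOn D U) (hU : IsOpen U)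
    (hx : x ∈ U) (hf : SmoothFunOn E f U) (hX : SmoothOn X U) (hY : SmoothOn Y U)
    (hZ : SmoothOn Z U) :
    curvature D X Y (fun y ↦ f y • Z y) x = f x • curvature D X Y Z x := by
  have hXZ := hD U subset_rfl hU X Z hX hZ
  have hYZ := hD U subset_rfl hU Y Z hY hZ
  have hXf := hf.deriv hU hX
  have hYf := hf.deriv hU hY
  have e : ∀ W : VF E M, ∀ y ∈ U, D (fun y ↦ f y • Z y) y (W y) =
      f y • D Z y (W y) + mvfderiv 𝓘(ℝ, E) f y (W y) • Z y := fun W y hy ↦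
    Connection.smul_section D _ (hf.mdiffAt hU hy) (hZ.mdiffAt hU hy)
  unfold curvature
  rw [Connection.congr D hU hx (e Y) (((hYZ.smul hf).add (hZ.smul hYf)).mdiffAt hU hx),
    Connection.congr D hU hx (e X) (((hXZ.smul hf).add (hZ.smul hXf)).mdiffAt hU hx),
    Connection.add_section D _ ((hYZ.smul hf).mdiffAt hU hx) ((hZ.smul hYf).mdiffAt hU hx),
    Connection.add_section D _ ((hXZ.smul hf).mdiffAt hU hx) ((hZ.smul hXf).mdiffAt hU hx),
    Connection.smul_section D _ (hf.mdiffAt hU hx) (hXZ.mdiffAt hU hx),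
    Connection.smul_section D _ (hf.mdiffAt hU hx) (hYZ.mdiffAt hU hx),
    Connection.smul_section D _ (hf.mdiffAt hU hx) (hZ.mdiffAt hU hx),
    Connection.smul_section D _ (hXf.mdiffAt hU hx) (hZ.mdiffAt hU hx),
    Connection.smul_section D _ (hYf.mdiffAt hU hx) (hZ.mdiffAt hU hx),
    mvfderiv_mlieBracket hU hx hf hX hY]
  module

theorem curvature_add_right {Z' : VF E M} (hD : IsSmoothConnectionOn D U) (hU : IsOpen U)
    (hx : x ∈ U) (hX : SmoothOn X U) (hY : SmoothOn Y U) (hZ : SmoothOn Z U)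
    (hZ' : SmoothOn Z' U) :
    curvature D X Y (fun y ↦ Z y + Z' y) x = curvature D X Y Z x + curvature D X Y Z' x := by
  have e : ∀ W : VF E M, ∀ y ∈ U, D (fun y ↦ Z y + Z' y) y (W y) =
      D Z y (W y) + D Z' y (W y) := fun W y hy ↦
    Connection.add_section D _ (hZ.mdiffAt hU hy) (hZ'.mdiffAt hU hy)
  have h := hD U subset_rfl hU
  unfold curvature
  rw [Connection.congr D hU hx (e Y) (((h Y Z hY hZ).add (h Y Z' hY hZ')).mdiffAt hU hx),
    Connection.congr D hU hx (e X) (((h X Z hX hZ).add (h X Z' hX hZ')).mdiffAt hU hx),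
    Connection.add_section D _ ((h Y Z hY hZ).mdiffAt hU hx) ((h Y Z' hY hZ').mdiffAt hU hx),
    Connection.add_section D _ ((h X Z hX hZ).mdiffAt hU hx) ((h X Z' hX hZ').mdiffAt hU hx),
    Connection.add_section D _ (hZ.mdiffAt hU hx) (hZ'.mdiffAt hU hx)]
  abel

end Calculus

/-! ### Orthonormal frames -/

section Frames

variable {E : Type*} [NormedAddCommGroup E] [NormedSpace ℝ E] [FiniteDimensional ℝ E]
  {M : Type*} [TopologicalSpace M] [ChartedSpace E M] [IsManifold 𝓘(ℝ, E) ∞ M]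

/-- The Koszul formula for vector fields with constant inner products involves brackets only. -/
theorem inner_leviCivita_of_const (g : Metric E M) {U : Set M} {x : M} {X Y Z : VF E M}
    (hU : IsOpen U) (hx : x ∈ U) (hX : SmoothOn X U) (hY : SmoothOn Y U) (hZ : SmoothOn Z U)
    {a b c : ℝ} (hYZ : ∀ y ∈ U, g.inner y (Y y) (Z y) = a)
    (hXZ : ∀ y ∈ U, g.inner y (X y) (Z y) = b) (hXY : ∀ y ∈ U, g.inner y (X y) (Y y) = c) :
    g.inner x (leviCivita g Y x (X x)) (Z x) =
      (g.inner x (mlieBracket 𝓘(ℝ, E) X Y x) (Z x)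
        - g.inner x (mlieBracket 𝓘(ℝ, E) X Z x) (Y x)
        - g.inner x (mlieBracket 𝓘(ℝ, E) Y Z x) (X x)) / 2 := by
  refine (inner_leviCivitaAux g (hX.mdiffAt hU hx) (hY.mdiffAt hU hx) (hZ.mdiffAt hU hx)).trans ?_
  simp only [koszul, dInner, mvfderiv_congr hU hx hYZ, mvfderiv_congr hU hx hXZ,
    mvfderiv_congr hU hx hXY, mvfderiv_const, zero_apply]
  ring

/-- On the open set `U`, the fields `e 0, e 1, e 2` are smooth and orthonormal. -/
structure IsOrthonormalFrameOn (g : Metric E M) (U : Set M) (e : Fin 3 → VF E M) : Prop where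
  isOpen : IsOpen U
  smooth : ∀ i, SmoothOn (e i) U
  orthonormal : ∀ x ∈ U, ∀ i j, g.inner x (e i x) (e j x) = if i = j then 1 else 0

namespace IsOrthonormalFrameOn

variable {g : Metric E M} {U V : Set M} {e : Fin 3 → VF E M} {X Y Z : VF E M} {x : M}

theorem mono (he : IsOrthonormalFrameOn g U e) (hV : IsOpen V) (h : V ⊆ U) :
    IsOrthonormalFrameOn g V e :=
  ⟨hV, fun i ↦ (he.smooth i).mono h, fun x hx ↦ he.orthonormal x (h hx)⟩

variable [hE : Fact (Module.finrank ℝ E = 3)]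

theorem expand (he : IsOrthonormalFrameOn g U e) (hx : x ∈ U) (v : TangentSpace 𝓘(ℝ, E) x) :
    v = ∑ i, g.inner x v (e i x) • e i x := by
  have hli : LinearIndependent ℝ (fun i ↦ e i x) := by
    rw [Fintype.linearIndependent_iff]
    intro c hc j
    have h := congrArg (fun w ↦ g.inner x w (e j x)) hc
    simpa [he.orthonormal x hx] using h
  have hcard : Fintype.card (Fin 3) = Module.finrank ℝ (TangentSpace 𝓘(ℝ, E) x) :=
    (Fintype.card_fin 3).trans hE.out.symm
  let b := basisOfLinearIndependentOfCardEqFinrank hli hcard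
  have hb : ∀ i, b i = e i x := fun i ↦ by simp [b]
  have h := b.sum_repr v
  have hc : ∀ j, g.inner x v (e j x) = b.repr v j := by
    intro j
    conv_lhs => rw [← h]
    simp [hb, he.orthonormal x hx]
  conv_lhs => rw [← h]
  simp [hc, hb]

theorem ext (he : IsOrthonormalFrameOn g U e) (hx : x ∈ U) {v w : TangentSpace 𝓘(ℝ, E) x}
    (h : ∀ i, g.inner x v (e i x) = g.inner x w (e i x)) : v = w := by
  rw [he.expand hx v, he.expand hx w]
  simp only [h]

theorem mvfderiv_inner_eq_zero (he : IsOrthonormalFrameOn g U e) (hx : x ∈ U) (i j : Fin 3) :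
    mvfderiv 𝓘(ℝ, E) (fun y ↦ g.inner y (e i y) (e j y)) x = 0 := by
  rw [mvfderiv_congr he.isOpen hx (fun y hy ↦ he.orthonormal y hy i j), mvfderiv_const]

theorem inner_leviCivita (he : IsOrthonormalFrameOn g U e) (hx : x ∈ U) (i j k : Fin 3) :
    g.inner x (leviCivita g (e j) x (e i x)) (e k x) =
      (g.inner x (mlieBracket 𝓘(ℝ, E) (e i) (e j) x) (e k x)
        - g.inner x (mlieBracket 𝓘(ℝ, E) (e i) (e k) x) (e j x)
        - g.inner x (mlieBracket 𝓘(ℝ, E) (e j) (e k) x) (e i x)) / 2 :=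
  inner_leviCivita_of_const g he.isOpen hx (he.smooth i) (he.smooth j) (he.smooth k)
    (fun y hy ↦ he.orthonormal y hy j k) (fun y hy ↦ he.orthonormal y hy i k)
    (fun y hy ↦ he.orthonormal y hy i j)

/-- `∇_X Y` is smooth for smooth `X` and `Y`, as its components in the frame are given by the Koszul
formula. -/
theorem isSmoothConnectionOn (he : IsOrthonormalFrameOn g U e) :
    IsSmoothConnectionOn (leviCivita g) U := by
  intro V hVU hV X Y hX hY
  have he' := fun k ↦ (he.smooth k).mono hVU
  have hk : ∀ k, SmoothFunOn E (fun y ↦ koszul g X Y (e k) y) V := by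
    intro k
    have h1 := (hY.inner g (he' k)).deriv hV hX
    have h2 := (hX.inner g (he' k)).deriv hV hY
    have h3 := (hX.inner g hY).deriv hV (he' k)
    have h4 := (hX.mlieBracket hV hY).inner g (he' k)
    have h5 := (hX.mlieBracket hV (he' k)).inner g hY
    have h6 := (hY.mlieBracket hV (he' k)).inner g hX
    refine ((SmoothFunOn.const (1 / 2 : ℝ)).mul
      (((((h1.add h2).sub h3).add h4).sub h5).sub h6)).congr fun y _ ↦ ?_
    simp only [koszul, dInner]
    ring
  refine (SmoothOn.sum (s := Finset.univ) fun k _ ↦ (he' k).smul (hk k)).congr fun y hy ↦ ?_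
  rw [he.expand (hVU hy) (leviCivita g Y y (X y))]
  refine Finset.sum_congr rfl fun k _ ↦ ?_
  rw [← inner_leviCivitaAux g (hX.mdiffAt hV hy) (hY.mdiffAt hV hy) ((he' k).mdiffAt hV hy)]
  rfl

theorem smooth_coeff (he : IsOrthonormalFrameOn g U e) (hX : SmoothOn X U) (i : Fin 3) :
    SmoothFunOn E (fun y ↦ g.inner y (X y) (e i y)) U := hX.inner g (he.smooth i)

theorem curvature_expand_left (he : IsOrthonormalFrameOn g U e) (hx : x ∈ U)
    (hX : SmoothOn X U) (hY : SmoothOn Y U) (hZ : SmoothOn Z U) :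
    curvature (leviCivita g) X Y Z x =
      ∑ i, g.inner x (X x) (e i x) • curvature (leviCivita g) (e i) Y Z x := by
  have hD := he.isSmoothConnectionOn
  have hU := he.isOpen
  have hs := fun i ↦ (he.smooth i).smul (he.smooth_coeff hX i)
  have h := curvature_congr hD hU hx (((hs 0).add (hs 1)).add (hs 2)) hY hZ (X' := X) (Y' := Y)
    (Z' := Z) (fun y hy ↦ by rw [← Fin.sum_univ_three (fun i ↦ g.inner y (X y) (e i y) • e i y)]
                             exact he.expand hy _) (fun _ _ ↦ rfl) (fun _ _ ↦ rfl)
  rw [h, curvature_add_left hD hU hx ((hs 0).add (hs 1)) (hs 2) hZ,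
    curvature_add_left hD hU hx (hs 0) (hs 1) hZ, Fin.sum_univ_three]
  simp only [curvature_smul_left hD hU hx (he.smooth_coeff hX _) (he.smooth _) hZ]

theorem curvature_expand_right (he : IsOrthonormalFrameOn g U e) (hx : x ∈ U)
    (hX : SmoothOn X U) (hY : SmoothOn Y U) (hZ : SmoothOn Z U) :
    curvature (leviCivita g) X Y Z x =
      ∑ i, g.inner x (Z x) (e i x) • curvature (leviCivita g) X Y (e i) x := by
  have hD := he.isSmoothConnectionOn
  have hU := he.isOpen
  have hs := fun i ↦ (he.smooth i).smul (he.smooth_coeff hZ i)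
  have h := curvature_congr hD hU hx hX hY (((hs 0).add (hs 1)).add (hs 2)) (X' := X) (Y' := Y)
    (Z' := Z) (fun _ _ ↦ rfl) (fun _ _ ↦ rfl)
    (fun y hy ↦ by rw [← Fin.sum_univ_three (fun i ↦ g.inner y (Z y) (e i y) • e i y)]
                   exact he.expand hy _)
  rw [h, curvature_add_right hD hU hx hX hY ((hs 0).add (hs 1)) (hs 2),
    curvature_add_right hD hU hx hX hY (hs 0) (hs 1), Fin.sum_univ_three]
  simp only [curvature_smul_right hD hU hx (he.smooth_coeff hZ _) hX hY (he.smooth _)]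

/-- The curvature is determined by its values on a frame. -/
theorem curvature_expand (he : IsOrthonormalFrameOn g U e) (hx : x ∈ U)
    (hX : SmoothOn X U) (hY : SmoothOn Y U) (hZ : SmoothOn Z U) :
    curvature (leviCivita g) X Y Z x =
      ∑ i, ∑ j, ∑ k, (g.inner x (X x) (e i x) * g.inner x (Y x) (e j x) * g.inner x (Z x) (e k x))
        • curvature (leviCivita g) (e i) (e j) (e k) x := by
  rw [he.curvature_expand_left hx hX hY hZ]
  refine Finset.sum_congr rfl fun i _ ↦ ?_
  rw [curvature_swap, he.curvature_expand_left hx hY (he.smooth i) hZ, ← Finset.sum_neg_distrib,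
    Finset.smul_sum]
  refine Finset.sum_congr rfl fun j _ ↦ ?_
  rw [← smul_neg, ← curvature_swap, he.curvature_expand_right hx (he.smooth i) (he.smooth j) hZ]
  simp only [Finset.smul_sum, smul_smul, mul_assoc]

/-- For a metric connection with a parallel orthonormal frame, covariant differentiation is
differentiation of the components. -/
theorem connection_eq (he : IsOrthonormalFrameOn g U e) (hx : x ∈ U) {D : Connection E M}
    (hD : IsMetric g D) (hpar : ∀ i, D (e i) x = 0) (hX : MDiffAt (T% X) x)
    (v : TangentSpace 𝓘(ℝ, E) x) (i : Fin 3) :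
    g.inner x (D X x v) (e i x) = mvfderiv 𝓘(ℝ, E) (fun y ↦ g.inner y (X y) (e i y)) x v := by
  have h := hD X (e i) x hX ((he.smooth i).mdiffAt he.isOpen hx) v
  rw [hpar i] at h
  simpa [dInner] using h.symm

end IsOrthonormalFrameOn

end Frames

section AdaptedFrames

variable {E : Type*} [NormedAddCommGroup E] [NormedSpace ℝ E] [FiniteDimensional ℝ E]
  {M : Type*} [TopologicalSpace M] [ChartedSpace E M] [IsManifold 𝓘(ℝ, E) ∞ M]

namespace ContactStructure

variable {g : Metric E M} (C : ContactStructure g) {U V : Set M} {e : Fin 3 → VF E M}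
  {X Y Z : VF E M} {x : M}

/-! ### Pointwise algebra of a contact Riemannian structure -/

theorem ξ_ne_zero (x : M) : C.ξ x ≠ 0 := fun h ↦ by
  have := C.η_ξ x
  rw [h, map_zero] at this
  exact zero_ne_one this

theorem φ_ξ (x : M) : C.φ x (C.ξ x) = 0 := by
  have h1 : C.φ x (C.φ x (C.ξ x)) = 0 := by rw [C.φ_sq, C.η_ξ]; simp
  -- `φ³ ξ = 0` makes `φ ξ` a multiple of `ξ`, and then `φ² ξ = 0` makes the factor vanish
  have h2 := C.φ_sq x (C.φ x (C.ξ x))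
  rw [h1, map_zero] at h2
  have h3 : C.φ x (C.ξ x) = C.η x (C.φ x (C.ξ x)) • C.ξ x := by
    rw [eq_comm, neg_add_eq_zero] at h2; exact h2
  have h4 : C.η x (C.φ x (C.ξ x)) • C.φ x (C.ξ x) = 0 := by
    rw [← map_smul, ← h3, h1]
  rcases smul_eq_zero.1 h4 with h | h
  · rw [h3, h, zero_smul]
  · exact h

theorem inner_ξ (v : TangentSpace 𝓘(ℝ, E) x) : g.inner x v (C.ξ x) = C.η x v := by
  have h := C.compatible x v (C.ξ x)
  rw [C.φ_ξ, map_zero, C.η_ξ] at h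
  linarith

theorem η_φ (v : TangentSpace 𝓘(ℝ, E) x) : C.η x (C.φ x v) = 0 := by
  have h1 := C.φ_sq x (C.φ x v)
  have h2 := congrArg (C.φ x) (C.φ_sq x v)
  rw [map_add, map_neg, map_smul, C.φ_ξ, smul_zero, add_zero] at h2
  rw [h2, left_eq_add] at h1
  exact (smul_eq_zero.1 h1).resolve_right (C.ξ_ne_zero x)

theorem inner_φ_left (v w : TangentSpace 𝓘(ℝ, E) x) :
    g.inner x (C.φ x v) w = -g.inner x v (C.φ x w) := by
  have h := C.compatible x v (C.φ x w)
  rw [C.φ_sq, C.η_φ, map_add, map_neg, map_smul, C.inner_ξ, C.η_φ] at h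
  simp only [smul_eq_mul, mul_zero, add_zero, sub_zero] at h
  linarith

/-- The contact condition `dη(X,Y) = g(X, φY)` for locally defined fields. -/
theorem η_mlieBracket [T2Space M] (hU : IsOpen U) (hx : x ∈ U) (hX : SmoothOn X U)
    (hY : SmoothOn Y U) :
    C.η x (mlieBracket 𝓘(ℝ, E) X Y x) =
      mvfderiv 𝓘(ℝ, E) (fun y ↦ C.η y (Y y)) x (X x)
        - mvfderiv 𝓘(ℝ, E) (fun y ↦ C.η y (X y)) x (Y x) - 2 * g.inner x (X x) (C.φ x (Y x)) := by
  obtain ⟨X', hX', V, hVU, hV, hxV, eX⟩ := hX.exists_smooth_extension hU hx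
  obtain ⟨Y', hY', W, hWU, hW, hxW, eY⟩ := hY.exists_smooth_extension hU hx
  have h := C.contact X' Y' hX' hY' x
  have hO := hV.inter hW
  have hxO : x ∈ V ∩ W := ⟨hxV, hxW⟩
  rw [extDeriv₁, mlieBracket_congr (X' := X) (Y' := Y) hO hxO (fun y hy ↦ eX y hy.1)
    (fun y hy ↦ eY y hy.2), mvfderiv_congr (f := fun y ↦ C.η y (Y' y))
    (f' := fun y ↦ C.η y (Y y)) hO hxO (fun y hy ↦ by rw [eY y hy.2]),
    mvfderiv_congr (f := fun y ↦ C.η y (X' y))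
    (f' := fun y ↦ C.η y (X y)) hO hxO (fun y hy ↦ by rw [eX y hy.1]),
    eX x hxV, eY x hxW] at h
  linarith

/-! ### Adapted frames -/

/-- An orthonormal frame of the form `ξ, e 1, φ (e 1)`. -/
structure IsAdaptedFrameOn (U : Set M) (e : Fin 3 → VF E M) : Prop
    extends IsOrthonormalFrameOn g U e where
  ξ_eq : ∀ x ∈ U, C.ξ x = e 0 x
  φ_one : ∀ x ∈ U, C.φ x (e 1 x) = e 2 x

/-- A smooth section of the contact distribution is, where it does not vanish, the multiple of the
second field of an adapted frame by a positive factor. -/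
theorem exists_isAdaptedFrameOn (hU : IsOpen U) (hx : x ∈ U) (hX : SmoothOn X U)
    (hη : ∀ y ∈ U, C.η y (X y) = 0) (h0 : X x ≠ 0) :
    ∃ V ⊆ U, x ∈ V ∧ ∃ e, C.IsAdaptedFrameOn V e ∧ ∃ f : M → ℝ, ∀ y ∈ V, e 1 y = f y • X y := by
  have hXX := hX.inner g hX
  let V : Set M := {y ∈ U | X y ≠ 0}
  have hpos : ∀ y ∈ V, 0 < g.inner y (X y) (X y) := fun y hy ↦ g.pos y _ hy.2
  have hV : IsOpen V := by
    have : V = U ∩ (fun y ↦ g.inner y (X y) (X y)) ⁻¹' {0}ᶜ := by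
      ext y
      refine ⟨fun hy ↦ ⟨hy.1, (hpos y hy).ne'⟩, fun hy ↦ ⟨hy.1, fun h ↦ hy.2 ?_⟩⟩
      simp [h]
    rw [this]
    exact hXX.continuousOn.isOpen_inter_preimage hU isOpen_compl_singleton
  have hVU : V ⊆ U := fun y hy ↦ hy.1
  let f : M → ℝ := fun y ↦ (Real.sqrt (g.inner y (X y) (X y)))⁻¹
  have hf : SmoothFunOn E f V := by
    refine (hXX.mono hVU).comp (φ := fun t ↦ (Real.sqrt t)⁻¹) fun y hy ↦ ?_
    exact (Real.contDiffAt_sqrt (hpos y hy).ne').inv (Real.sqrt_pos.2 (hpos y hy)).ne'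
  obtain ⟨W, hW⟩ : ∃ W : VF E M, ∀ y, W y = f y • X y := ⟨fun y ↦ f y • X y, fun _ ↦ rfl⟩
  have h1 : SmoothOn W V := ((hX.mono hVU).smul hf).congr fun y _ ↦ hW y
  have n1 : ∀ y ∈ V, g.inner y (W y) (W y) = 1 := by
    intro y hy
    have h2 := Real.mul_self_sqrt (hpos y hy).le
    have h3 := Real.sqrt_pos.2 (hpos y hy)
    simp only [hW, map_smul, smul_apply, smul_eq_mul, f]
    nth_rw 3 [← h2]
    field_simp
  have z1 : ∀ y ∈ V, C.η y (W y) = 0 := fun y hy ↦ by rw [hW, map_smul, hη y hy.1, smul_zero]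
  refine ⟨V, hVU, ⟨hx, h0⟩, ![C.ξ, W, fun y ↦ C.φ y (W y)],
    ⟨⟨hV, ?_, ?_⟩, fun y _ ↦ rfl, fun y _ ↦ rfl⟩, f, fun y _ ↦ hW y⟩
  · intro i
    match i with
    | 0 => exact C.smooth_ξ.smoothOn V
    | 1 => exact h1
    | 2 => exact C.smooth_φ.apply h1
  · intro y hy i j
    have hn := n1 y hy
    have hz := z1 y hy
    have h2 : g.inner y (W y) (C.φ y (W y)) = 0 := by
      have := C.inner_φ_left (W y) (W y)
      rw [g.symm] at this
      linarith
    have h00 : g.inner y (C.ξ y) (C.ξ y) = 1 := by rw [C.inner_ξ, C.η_ξ]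
    have h22 : g.inner y (C.φ y (W y)) (C.φ y (W y)) = 1 := by rw [C.compatible, hn, hz]; simp
    have h10 : g.inner y (W y) (C.ξ y) = 0 := by rw [C.inner_ξ, hz]
    have h20 : g.inner y (C.φ y (W y)) (C.ξ y) = 0 := by rw [C.inner_ξ, C.η_φ]
    have h01 := (g.symm y (C.ξ y) (W y)).trans h10
    have h02 := (g.symm y (C.ξ y) (C.φ y (W y))).trans h20
    have h21 := (g.symm y (C.φ y (W y)) (W y)).trans h2
    have p : ∀ i : Fin 3, (1 : ℝ) = if i = i then 1 else 0 := fun i ↦ (if_pos rfl).symm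
    have q : ∀ {i j : Fin 3}, i ≠ j → (0 : ℝ) = if i = j then 1 else 0 := fun h ↦ (if_neg h).symm
    match i, j with
    | 0, 0 => exact h00.trans (p 0)
    | 0, 1 => exact h01.trans (q (by decide))
    | 0, 2 => exact h02.trans (q (by decide))
    | 1, 0 => exact h10.trans (q (by decide))
    | 1, 1 => exact hn.trans (p 1)
    | 1, 2 => exact h2.trans (q (by decide))
    | 2, 0 => exact h20.trans (q (by decide))
    | 2, 1 => exact h21.trans (q (by decide))
    | 2, 2 => exact h22.trans (p 2)

namespace IsAdaptedFrameOn

variable {C} (he : C.IsAdaptedFrameOn U e)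
include he

theorem η_eq (hx : x ∈ U) (v : TangentSpace 𝓘(ℝ, E) x) : C.η x v = g.inner x v (e 0 x) := by
  rw [← he.ξ_eq x hx, C.inner_ξ]

theorem η_frame (hx : x ∈ U) (i : Fin 3) : C.η x (e i x) = if i = 0 then 1 else 0 := by
  rw [he.η_eq hx, he.orthonormal x hx]

theorem φ_zero (hx : x ∈ U) : C.φ x (e 0 x) = 0 := by rw [← he.ξ_eq x hx, C.φ_ξ]

theorem φ_two (hx : x ∈ U) : C.φ x (e 2 x) = -e 1 x := by
  rw [← he.φ_one x hx, C.φ_sq, he.η_frame hx]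
  simp

variable [T2Space M]

theorem inner_bracket_zero (hx : x ∈ U) (i : Fin 3) :
    g.inner x (mlieBracket 𝓘(ℝ, E) (e 0) (e i) x) (e 0 x) = 0 := by
  rw [← he.η_eq hx, C.η_mlieBracket he.isOpen hx (he.smooth 0) (he.smooth i),
    mvfderiv_congr he.isOpen hx (fun y hy ↦ he.η_frame hy i),
    mvfderiv_congr he.isOpen hx (fun y hy ↦ he.η_frame hy 0), mvfderiv_const, mvfderiv_const,
    g.symm, ← he.η_eq hx, C.η_φ]
  simp

theorem inner_bracket_one_two (hx : x ∈ U) :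
    g.inner x (mlieBracket 𝓘(ℝ, E) (e 1) (e 2) x) (e 0 x) = 2 := by
  rw [← he.η_eq hx, C.η_mlieBracket he.isOpen hx (he.smooth 1) (he.smooth 2),
    mvfderiv_congr he.isOpen hx (fun y hy ↦ he.η_frame hy 1),
    mvfderiv_congr he.isOpen hx (fun y hy ↦ he.η_frame hy 2), mvfderiv_const, mvfderiv_const,
    he.φ_two hx, map_neg, he.orthonormal x hx]
  simp

/-- The flow of `ξ` preserves the area form `dη` of the contact distribution; infinitesimally, this
is the `ξ`-component of the Jacobi identity for the frame. -/
theorem inner_bracket_trace (hx : x ∈ U) :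
    g.inner x (mlieBracket 𝓘(ℝ, E) (e 0) (e 1) x) (e 1 x)
      + g.inner x (mlieBracket 𝓘(ℝ, E) (e 0) (e 2) x) (e 2 x) = 0 := by
  have hU := he.isOpen
  have s := he.smooth
  have b01 := (s 0).mlieBracket hU (s 1)
  have b02 := (s 0).mlieBracket hU (s 2)
  have b12 := (s 1).mlieBracket hU (s 2)
  have h := congrArg (C.η x) (jacobi hU hx (s 0) (s 1) (s 2))
  have z : ∀ y ∈ U, ∀ i, C.η y (mlieBracket 𝓘(ℝ, E) (e 0) (e i) y) = 0 := fun y hy i ↦ by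
    rw [he.η_eq hy, he.inner_bracket_zero hy]
  have t : ∀ y ∈ U, C.η y (mlieBracket 𝓘(ℝ, E) (e 1) (e 2) y) = 2 := fun y hy ↦ by
    rw [he.η_eq hy, he.inner_bracket_one_two hy]
  rw [map_add, C.η_mlieBracket hU hx (s 0) b12, C.η_mlieBracket hU hx b01 (s 2),
    C.η_mlieBracket hU hx (s 1) b02,
    mvfderiv_congr hU hx (fun y hy ↦ he.η_frame hy 0),
    mvfderiv_congr hU hx (fun y hy ↦ he.η_frame hy 1),
    mvfderiv_congr hU hx (fun y hy ↦ he.η_frame hy 2),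
    mvfderiv_congr hU hx (fun y hy ↦ z y hy 1), mvfderiv_congr hU hx (fun y hy ↦ z y hy 2),
    mvfderiv_congr hU hx t, he.φ_two hx, map_neg,
    ← neg_neg (g.inner x (e 0 x) _), ← C.inner_φ_left, he.φ_zero hx,
    ← neg_neg (g.inner x (e 1 x) _), ← C.inner_φ_left, he.φ_one x hx, g.symm x (e 2 x)] at h
  simp only [mvfderiv_const, zero_apply, map_zero] at h
  linarith

/-- The components of `h` in an adapted frame. -/
theorem h_one (hx : x ∈ U) : C.h x (e 1 x) =
    (2⁻¹ : ℝ) • (mlieBracket 𝓘(ℝ, E) (e 0) (e 2) x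
      - C.φ x (mlieBracket 𝓘(ℝ, E) (e 0) (e 1) x)) := by
  rw [C.h_apply ((he.smooth 1).mdiffAt he.isOpen hx), hField,
    mlieBracket_congr he.isOpen hx he.ξ_eq he.φ_one,
    mlieBracket_congr he.isOpen hx he.ξ_eq (fun _ _ ↦ rfl)]

theorem h_two (hx : x ∈ U) : C.h x (e 2 x) =
    (2⁻¹ : ℝ) • (-mlieBracket 𝓘(ℝ, E) (e 0) (e 1) x
      - C.φ x (mlieBracket 𝓘(ℝ, E) (e 0) (e 2) x)) := by
  rw [C.h_apply ((he.smooth 2).mdiffAt he.isOpen hx), hField,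
    mlieBracket_congr he.isOpen hx he.ξ_eq (fun y hy ↦ (he.φ_two hy).trans
      (neg_one_smul ℝ _).symm),
    mlieBracket_congr he.isOpen hx he.ξ_eq (fun _ _ ↦ rfl)]
  congr 2
  have := mlieBracket_const_smul_right (c := (-1 : ℝ)) (V := e 0)
    ((he.smooth 1).mdiffAt he.isOpen hx)
  exact this.trans (neg_one_smul ℝ _)

theorem h_zero (hx : x ∈ U) : C.h x (e 0 x) = 0 := by
  rw [C.h_apply ((he.smooth 0).mdiffAt he.isOpen hx), hField,
    mlieBracket_congr he.isOpen hx he.ξ_eq (fun y hy ↦ he.φ_zero hy),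
    mlieBracket_congr he.isOpen hx he.ξ_eq (fun _ _ ↦ rfl)]
  have h0 : mlieBracket 𝓘(ℝ, E) (e 0) (fun _ ↦ 0) = 0 := mlieBracket_zero_right
  rw [h0]
  simp

end IsAdaptedFrameOn

end ContactStructure

end AdaptedFrames

/-! ### The Levi-Civita connection in an adapted frame -/

section AdaptedFrames

variable {E : Type*} [NormedAddCommGroup E] [NormedSpace ℝ E] [FiniteDimensional ℝ E]
  {M : Type*} [TopologicalSpace M] [ChartedSpace E M] [IsManifold 𝓘(ℝ, E) ∞ M]

namespace ContactStructure

variable {g : Metric E M} (C : ContactStructure g) {U : Set M} {e : Fin 3 → VF E M}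
  {x : M}

/-- An adapted frame together with its structure functions: `α` and `β` are the components
`g(h e₁, e₁)` and `g(h e₁, e₂)`, and `a`, `b`, `c` are the components `g(∇_{e_i} e₁, e₂)` for
`i = 0, 1, 2`. -/
structure IsAdaptedFrameWith (U : Set M) (e : Fin 3 → VF E M) (α β a b c : M → ℝ) : Prop
    extends C.IsAdaptedFrameOn U e where
  smooth_α : SmoothFunOn E α U
  smooth_β : SmoothFunOn E β U
  bracket_zero_one : ∀ x ∈ U, mlieBracket 𝓘(ℝ, E) (e 0) (e 1) x =
    -β x • e 1 x + (α x + a x + 1) • e 2 x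
  bracket_zero_two : ∀ x ∈ U, mlieBracket 𝓘(ℝ, E) (e 0) (e 2) x =
    (α x - a x - 1) • e 1 x + β x • e 2 x
  bracket_one_two : ∀ x ∈ U, mlieBracket 𝓘(ℝ, E) (e 1) (e 2) x =
    (2 : ℝ) • e 0 x - b x • e 1 x - c x • e 2 x

variable {C} {α β a b c : M → ℝ} [T2Space M] [Fact (Module.finrank ℝ E = 3)]

/-- The brackets of an adapted frame have the shape described by `IsAdaptedFrameWith`. -/
theorem IsAdaptedFrameOn.exists_coefficients (he : C.IsAdaptedFrameOn U e) :
    ∃ α β a b c, C.IsAdaptedFrameWith U e α β a b c := by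
  let s : Fin 3 → Fin 3 → Fin 3 → M → ℝ := fun i j k y ↦
    g.inner y (mlieBracket 𝓘(ℝ, E) (e i) (e j) y) (e k y)
  have hs : ∀ i j k, SmoothFunOn E (s i j k) U := fun i j k ↦
    ((he.smooth i).mlieBracket he.isOpen (he.smooth j)).inner g (he.smooth k)
  refine ⟨fun y ↦ 1 / 2 * (s 0 1 2 y + s 0 2 1 y), s 0 2 2,
    fun y ↦ 1 / 2 * (s 0 1 2 y - s 0 2 1 y) - 1, fun y ↦ -s 1 2 1 y, fun y ↦ -s 1 2 2 y,
    he, (SmoothFunOn.const _).mul ((hs 0 1 2).add (hs 0 2 1)), hs 0 2 2, ?_, ?_, ?_⟩ <;>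
    intro x hx
  · have h := he.inner_bracket_trace hx
    conv_lhs => rw [he.expand hx (mlieBracket 𝓘(ℝ, E) (e 0) (e 1) x)]
    rw [Fin.sum_univ_three, he.inner_bracket_zero hx, eq_neg_of_add_eq_zero_left h]
    simp only [s]
    module
  · conv_lhs => rw [he.expand hx (mlieBracket 𝓘(ℝ, E) (e 0) (e 2) x)]
    rw [Fin.sum_univ_three, he.inner_bracket_zero hx]
    simp only [s]
    module
  · conv_lhs => rw [he.expand hx (mlieBracket 𝓘(ℝ, E) (e 1) (e 2) x)]
    rw [Fin.sum_univ_three, he.inner_bracket_one_two hx]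
    simp only [s]
    module

namespace IsAdaptedFrameWith

variable (he : C.IsAdaptedFrameWith U e α β a b c)
include he

theorem h_one (hx : x ∈ U) : C.h x (e 1 x) = α x • e 1 x + β x • e 2 x := by
  rw [IsAdaptedFrameOn.h_one he.toIsAdaptedFrameOn hx, he.bracket_zero_one x hx,
      he.bracket_zero_two x hx, map_add, map_smul,
    map_smul, he.φ_one x hx, he.φ_two hx]
  module

theorem h_two (hx : x ∈ U) : C.h x (e 2 x) = β x • e 1 x - α x • e 2 x := by
  rw [IsAdaptedFrameOn.h_two he.toIsAdaptedFrameOn hx, he.bracket_zero_one x hx,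
      he.bracket_zero_two x hx, map_add, map_smul,
    map_smul, he.φ_one x hx, he.φ_two hx]
  module

theorem leviCivita_frame (hx : x ∈ U) :
    leviCivita g (e 0) x (e 0 x) = 0 ∧
    leviCivita g (e 0) x (e 1 x) = β x • e 1 x - (1 + α x) • e 2 x ∧
    leviCivita g (e 0) x (e 2 x) = (1 - α x) • e 1 x - β x • e 2 x ∧
    leviCivita g (e 1) x (e 0 x) = a x • e 2 x ∧
    leviCivita g (e 1) x (e 1 x) = -β x • e 0 x + b x • e 2 x ∧
    leviCivita g (e 1) x (e 2 x) = (α x - 1) • e 0 x + c x • e 2 x ∧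
    leviCivita g (e 2) x (e 0 x) = -a x • e 1 x ∧
    leviCivita g (e 2) x (e 1 x) = (1 + α x) • e 0 x - b x • e 1 x ∧
    leviCivita g (e 2) x (e 2 x) = β x • e 0 x - c x • e 1 x := by
  have o := he.orthonormal x hx
  have b01 := he.bracket_zero_one x hx
  have b02 := he.bracket_zero_two x hx
  have b12 := he.bracket_one_two x hx
  have b10 := (mlieBracket_swap_apply (I := 𝓘(ℝ, E)) (V := e 1) (W := e 0) (x := x)).trans
    (congrArg _ b01)
  have b20 := (mlieBracket_swap_apply (I := 𝓘(ℝ, E)) (V := e 2) (W := e 0) (x := x)).trans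
    (congrArg _ b02)
  have b21 := (mlieBracket_swap_apply (I := 𝓘(ℝ, E)) (V := e 2) (W := e 1) (x := x)).trans
    (congrArg _ b12)
  have e3 : ∀ {v w : TangentSpace 𝓘(ℝ, E) x}, g.inner x v (e 0 x) = g.inner x w (e 0 x) →
      g.inner x v (e 1 x) = g.inner x w (e 1 x) → g.inner x v (e 2 x) = g.inner x w (e 2 x) →
      v = w := fun h0 h1 h2 ↦ he.ext hx fun k ↦ match k with
    | 0 => h0
    | 1 => h1
    | 2 => h2
  refine ⟨?_, ?_, ?_, ?_, ?_, ?_, ?_, ?_, ?_⟩ <;> apply e3 <;>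
    simp only [he.inner_leviCivita hx, b01, b02, b12, b10, b20, b21, mlieBracket_self, map_add,
      map_sub, map_neg, map_smul, add_apply, sub_apply, neg_apply, smul_apply, smul_eq_mul, o,
      map_zero, zero_apply, Pi.zero_apply] <;> simp <;> ring

end IsAdaptedFrameWith

end ContactStructure

end AdaptedFrames

section AdaptedFrames

variable {E : Type*} [NormedAddCommGroup E] [NormedSpace ℝ E] [FiniteDimensional ℝ E]
  {M : Type*} [TopologicalSpace M] [ChartedSpace E M] [IsManifold 𝓘(ℝ, E) ∞ M]

/-! ### Curvature of a contact `(κ, μ)`-space -/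

namespace ContactStructure

variable {g : Metric E M} {C : ContactStructure g} {U : Set M} {e : Fin 3 → VF E M}
  {X Y : VF E M} {x : M} {α β a b c : M → ℝ} [T2Space M] [Fact (Module.finrank ℝ E = 3)]
  {κ μ : ℝ}

/-- The `(κ, μ)`-condition for locally defined fields. -/
theorem IsAdaptedFrameOn.curvature_ξ (he : C.IsAdaptedFrameOn U e) (hC : C.IsKappaMu κ μ)
    (hx : x ∈ U) (hX : SmoothOn X U) (hY : SmoothOn Y U) :
    curvature (leviCivita g) X Y (e 0) x =
      κ • (C.η x (Y x) • X x - C.η x (X x) • Y x)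
        + μ • C.h x (C.η x (Y x) • X x - C.η x (X x) • Y x) := by
  obtain ⟨X', hX', V, hVU, hV, hxV, eX⟩ := hX.exists_smooth_extension he.isOpen hx
  obtain ⟨Y', hY', W, hWU, hW, hxW, eY⟩ := hY.exists_smooth_extension he.isOpen hx
  have h := hC X' Y' hX' hY' x
  have hO := Set.inter_subset_left.trans hVU (a := V ∩ W)
  rw [curvature_congr (he.isSmoothConnectionOn.mono hO) (hV.inter hW) ⟨hxV, hxW⟩ (hX.mono hO)
    (hY.mono hO) ((he.smooth 0).mono hO) (fun y hy ↦ eX y hy.1) (fun y hy ↦ eY y hy.2)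
    (fun y hy ↦ he.ξ_eq y (hO hy)), eX x hxV, eY x hxW] at h
  exact h

namespace IsAdaptedFrameWith

variable (he : C.IsAdaptedFrameWith U e α β a b c)
include he

/-- The curvature component `g(R(e₁, ξ)ξ, e₁)` in terms of the structure functions. -/
theorem inner_curvature_one_zero_zero (hx : x ∈ U) :
    g.inner x (curvature (leviCivita g) (e 1) (e 0) (e 0) x) (e 1 x) =
      -mvfderiv 𝓘(ℝ, E) β x (e 0 x) - (1 + α x) * a x - β x ^ 2
        + (α x + a x + 1) * (1 - α x) := by
  have hU := he.isOpen
  have s := he.smooth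
  have hα1 := (SmoothFunOn.const 1).add he.smooth_α
  have e0 : ∀ y ∈ U, leviCivita g (e 0) y (e 0 y) = 0 := fun y hy ↦ (he.leviCivita_frame hy).1
  have e1 : ∀ y ∈ U, leviCivita g (e 0) y (e 1 y) = β y • e 1 y - (1 + α y) • e 2 y :=
    fun y hy ↦ (he.leviCivita_frame hy).2.1
  obtain ⟨-, l1, l2, l3, l4, l5, l6, l7, l8⟩ := he.leviCivita_frame hx
  have d1 := (s 1).smul he.smooth_β
  have d2 := (s 2).smul hα1
  have o := he.orthonormal x hx
  unfold curvature
  rw [Connection.congr _ hU hx e0 (mdifferentiable_zeroSection ..),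
    Connection.congr _ hU hx e1 ((d1.sub d2).mdiffAt hU hx), Connection.zero_section,
    Connection.sub_section _ _ (d1.mdiffAt hU hx) (d2.mdiffAt hU hx),
    Connection.smul_section _ _ (he.smooth_β.mdiffAt hU hx) ((s 1).mdiffAt hU hx),
    Connection.smul_section _ _ (hα1.mdiffAt hU hx) ((s 2).mdiffAt hU hx), l3, l6,
    mlieBracket_swap_apply, he.bracket_zero_one x hx]
  simp only [map_add, map_sub, map_neg, map_smul, add_apply, sub_apply, neg_apply, smul_apply,
    smul_eq_mul, l1, l2, map_zero, zero_apply, o]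
  simp
  ring

/-- The curvature component `g(R(e₂, ξ)ξ, e₂)` in terms of the structure functions. -/
theorem inner_curvature_two_zero_zero (hx : x ∈ U) :
    g.inner x (curvature (leviCivita g) (e 2) (e 0) (e 0) x) (e 2 x) =
      mvfderiv 𝓘(ℝ, E) β x (e 0 x) - (1 - α x) * a x - β x ^ 2
        - (α x - a x - 1) * (1 + α x) := by
  have hU := he.isOpen
  have s := he.smooth
  have hα1 := (SmoothFunOn.const 1).sub he.smooth_α
  have e0 : ∀ y ∈ U, leviCivita g (e 0) y (e 0 y) = 0 := fun y hy ↦ (he.leviCivita_frame hy).1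
  have e1 : ∀ y ∈ U, leviCivita g (e 0) y (e 2 y) = (1 - α y) • e 1 y - β y • e 2 y :=
    fun y hy ↦ (he.leviCivita_frame hy).2.2.1
  obtain ⟨-, l1, l2, l3, l4, l5, l6, l7, l8⟩ := he.leviCivita_frame hx
  have d1 := (s 1).smul hα1
  have d2 := (s 2).smul he.smooth_β
  have o := he.orthonormal x hx
  unfold curvature
  rw [Connection.congr _ hU hx e0 (mdifferentiable_zeroSection ..),
    Connection.congr _ hU hx e1 ((d1.sub d2).mdiffAt hU hx), Connection.zero_section,
    Connection.sub_section _ _ (d1.mdiffAt hU hx) (d2.mdiffAt hU hx),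
    Connection.smul_section _ _ (he.smooth_β.mdiffAt hU hx) ((s 2).mdiffAt hU hx),
    Connection.smul_section _ _ (hα1.mdiffAt hU hx) ((s 1).mdiffAt hU hx), l3, l6,
    mlieBracket_swap_apply, he.bracket_zero_two x hx]
  simp only [map_add, map_sub, map_neg, map_smul, add_apply, sub_apply, neg_apply, smul_apply,
    smul_eq_mul, l1, l2, map_zero, zero_apply, o]
  simp
  ring

/-- `κ = 1 - |h|²/2`: this is the Ricci curvature `2κ` in the direction of `ξ`, in which the
derivatives of the structure functions cancel. -/
theorem kappa_eq (hC : C.IsKappaMu κ μ) (hx : x ∈ U) : κ = 1 - α x ^ 2 - β x ^ 2 := by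
  have o := he.orthonormal x hx
  have h1 := he.inner_curvature_one_zero_zero hx
  have h2 := he.inner_curvature_two_zero_zero hx
  rw [he.curvature_ξ hC hx (he.smooth 1) (he.smooth 0)] at h1
  rw [he.curvature_ξ hC hx (he.smooth 2) (he.smooth 0)] at h2
  simp [he.η_frame hx, he.h_one hx, o] at h1
  simp [he.η_frame hx, he.h_two hx, o] at h2
  linarith

/-- In an eigenframe of `h`, the `(κ, μ)`-condition determines all the structure functions. -/
theorem coefficients_eq (hC : C.IsKappaMu κ μ) {l : ℝ} (hl : l ≠ 0) (hα : ∀ y ∈ U, α y = l)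
    (hβ : ∀ y ∈ U, β y = 0) (hx : x ∈ U) : a x = -μ / 2 ∧ b x = 0 ∧ c x = 0 := by
  have o := he.orthonormal x hx
  have hU := he.isOpen
  have s := he.smooth
  have hk := he.kappa_eq hC hx
  -- `g(R(e₁, ξ)ξ, e₁) = κ + μ l` gives `a`
  have ha := he.inner_curvature_one_zero_zero hx
  rw [he.curvature_ξ hC hx (he.smooth 1) (he.smooth 0), mvfderiv_congr hU hx hβ,
    mvfderiv_const] at ha
  simp [he.η_frame hx, he.h_one hx, o] at ha
  rw [hα x hx, hβ x hx] at ha hk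
  -- `R(e₁, e₂)ξ = 0` gives `b` and `c`
  have hbc := he.curvature_ξ hC hx (he.smooth 1) (he.smooth 2)
  have e1 : ∀ y ∈ U, leviCivita g (e 0) y (e 1 y) = -(1 + l) • e 2 y := fun y hy ↦ by
    rw [(he.leviCivita_frame hy).2.1, hα y hy, hβ y hy]; module
  have e2 : ∀ y ∈ U, leviCivita g (e 0) y (e 2 y) = (1 - l) • e 1 y := fun y hy ↦ by
    rw [(he.leviCivita_frame hy).2.2.1, hα y hy, hβ y hy]; module
  obtain ⟨l0, l1, l2, l3, l4, l5, l6, l7, l8⟩ := he.leviCivita_frame hx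
  unfold curvature at hbc
  rw [Connection.congr _ hU hx e1 (((s 2).const_smul _).mdiffAt hU hx),
    Connection.congr _ hU hx e2 (((s 1).const_smul _).mdiffAt hU hx),
    Connection.const_smul_section _ _ _ ((s 2).mdiffAt hU hx),
    Connection.const_smul_section _ _ _ ((s 1).mdiffAt hU hx), l4, l8,
    he.bracket_one_two x hx] at hbc
  simp only [map_sub, map_smul, l0, e1 x hx, e2 x hx, he.η_frame hx, hβ x hx] at hbc
  have hb := congrArg (fun v ↦ g.inner x v (e 2 x)) hbc
  have hc := congrArg (fun v ↦ g.inner x v (e 1 x)) hbc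
  simp [o] at hb hc
  refine ⟨?_, ?_, ?_⟩ <;> apply mul_left_cancel₀ hl <;> linarith

end IsAdaptedFrameWith

end ContactStructure

end AdaptedFrames

/-! ### The Sasakian case -/

section AdaptedFrames

variable {E : Type*} [NormedAddCommGroup E] [NormedSpace ℝ E] [FiniteDimensional ℝ E]
  {M : Type*} [TopologicalSpace M] [ChartedSpace E M] [IsManifold 𝓘(ℝ, E) ∞ M]

namespace ContactStructure

variable {g : Metric E M} {C : ContactStructure g} {U : Set M} {e : Fin 3 → VF E M}
  {x : M} {α β a b c : M → ℝ} [T2Space M] [hE : Fact (Module.finrank ℝ E = 3)]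
  {κ μ l : ℝ}

/-- The frame is built from a field that is not proportional to `ξ`, by projection to the contact
distribution. -/
theorem exists_adaptedFrame (C : ContactStructure g) (p : M) :
    ∃ U e, p ∈ U ∧ C.IsAdaptedFrameOn U e := by
  obtain ⟨v, hv⟩ : ∃ v : TangentSpace 𝓘(ℝ, E) p, v ∉ Submodule.span ℝ {C.ξ p} := by
    by_contra! h
    have h1 := finrank_span_le_card (R := ℝ) ({C.ξ p} : Set (TangentSpace 𝓘(ℝ, E) p))
    rw [Submodule.eq_top_iff'.2 h, finrank_top] at h1
    have h2 : Module.finrank ℝ (TangentSpace 𝓘(ℝ, E) p) = 3 := hE.out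
    simp [h2] at h1
  obtain ⟨U, X, hU, hp, hX, rfl⟩ := exists_smoothOn_extend v
  have hY := hX.sub ((C.smooth_ξ.smoothOn U).smul (C.smooth_η.apply hX))
  obtain ⟨V, -, hpV, e, he, -⟩ := C.exists_isAdaptedFrameOn hU hp hY
    (fun y _ ↦ by simp [C.η_ξ]) (fun h ↦ hv (by
      rw [sub_eq_zero.1 h]
      exact Submodule.smul_mem _ _ (Submodule.mem_span_singleton_self _)))
  exact ⟨V, e, hpV, he⟩

/-- A three-dimensional contact `(1, μ)`-space is Sasakian, since `h = 0`. -/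
theorem IsKappaMu.isSasakian (hC : C.IsKappaMu 1 μ) : C.IsSasakian := by
  intro X Y hX hY x
  obtain ⟨U, e, hx, he'⟩ := C.exists_adaptedFrame x
  obtain ⟨α, β, a, b, c, he⟩ := he'.exists_coefficients
  have hU := he.isOpen
  have s := fun i ↦ (he.smooth i).mdiffAt hU hx
  have hk := he.kappa_eq hC hx
  have hα : α x = 0 := by nlinarith [sq_nonneg (α x), sq_nonneg (β x)]
  have hβ : β x = 0 := by nlinarith [sq_nonneg (α x), sq_nonneg (β x)]
  have hy := fun i ↦ he.smooth_coeff (hY.smoothOn U) i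
  have hyd := fun i ↦ (hy i).mdiffAt hU hx
  have hs := fun i ↦ (he.smooth i).smul (hy i)
  have hsd := fun i ↦ (hs i).mdiffAt hU hx
  have eY : ∀ y ∈ U, Y y = g.inner y (Y y) (e 0 y) • e 0 y + g.inner y (Y y) (e 1 y) • e 1 y
      + g.inner y (Y y) (e 2 y) • e 2 y := fun y hy ↦ by
    rw [← Fin.sum_univ_three (fun i ↦ g.inner y (Y y) (e i y) • e i y)]
    exact he.expand hy _
  have eφ : ∀ y ∈ U, C.φ y (Y y) = g.inner y (Y y) (e 1 y) • e 2 y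
      - g.inner y (Y y) (e 2 y) • e 1 y := fun y hy ↦ by
    conv_lhs => rw [eY y hy]
    simp only [map_add, map_smul, he.φ_zero hy, he.φ_one y hy, he.φ_two hy]
    module
  have h1 := (he.smooth 2).smul (hy 1)
  have h2 := (he.smooth 1).smul (hy 2)
  rw [Connection.congr _ hU hx eφ ((h1.sub h2).mdiffAt hU hx),
    Connection.congr _ hU hx eY ((((hs 0).add (hs 1)).add (hs 2)).mdiffAt hU hx),
    Connection.sub_section _ _ (h1.mdiffAt hU hx) (h2.mdiffAt hU hx),
    Connection.add_section _ _ (((hs 0).add (hs 1)).mdiffAt hU hx) (hsd 2),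
    Connection.add_section _ _ (hsd 0) (hsd 1),
    Connection.smul_section _ _ (hyd 1) (s 2), Connection.smul_section _ _ (hyd 2) (s 1),
    Connection.smul_section _ _ (hyd 0) (s 0), Connection.smul_section _ _ (hyd 1) (s 1),
    Connection.smul_section _ _ (hyd 2) (s 2), g.symm x (X x), he.ξ_eq x hx, he.η_eq hx]
  have eX := he.expand hx (X x)
  rw [Fin.sum_univ_three] at eX
  obtain ⟨l0, l1, l2, l3, l4, l5, l6, l7, l8⟩ := he.leviCivita_frame hx
  have o := he.orthonormal x hx
  generalize g.inner x (X x) (e 0 x) = x0 at eX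
  generalize g.inner x (X x) (e 1 x) = x1 at eX
  generalize g.inner x (X x) (e 2 x) = x2 at eX
  rw [eX]
  simp only [map_add, map_smul, map_sub, map_zero, l0, l1, l2, l3, l4, l5, l6, l7, l8, hα, hβ,
    he.φ_zero hx, he.φ_one x hx, he.φ_two hx, smul_eq_mul]
  module

/-- Failure of the Sasakian condition also provides a point of `M`, without which `κ` would be
arbitrary. -/
theorem IsKappaMu.kappa_lt_one (hC : C.IsKappaMu κ μ) (hS : ¬C.IsSasakian) : κ < 1 := by
  refine lt_of_le_of_ne ?_ fun h ↦ hS (h ▸ hC).isSasakian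
  simp only [IsSasakian, not_forall] at hS
  obtain ⟨-, -, -, -, x, -⟩ := hS
  obtain ⟨U, e, hx, he'⟩ := C.exists_adaptedFrame x
  obtain ⟨α, β, a, b, c, he⟩ := he'.exists_coefficients
  rw [he.kappa_eq hC hx]
  nlinarith [sq_nonneg (α x), sq_nonneg (β x)]

/-! ### Eigenframes of `h` -/

variable (C) in
/-- An adapted frame with `h e₁ = l e₁` whose structure functions are the constants which they are
in a contact `(κ, μ)`-space. -/
abbrev IsEigenframeOn (U : Set M) (e : Fin 3 → VF E M) (l μ : ℝ) : Prop :=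
  C.IsAdaptedFrameWith U e (fun _ ↦ l) (fun _ ↦ 0) (fun _ ↦ -μ / 2) (fun _ ↦ 0) (fun _ ↦ 0)

/-- An adapted frame of a contact `(κ, μ)`-space whose second field is an eigenvector of `h` for a
constant eigenvalue `l ≠ 0` is an eigenframe. -/
theorem IsAdaptedFrameOn.isEigenframeOn (he : C.IsAdaptedFrameOn U e) (hC : C.IsKappaMu κ μ)
    (hl : l ≠ 0) (h1 : ∀ y ∈ U, C.h y (e 1 y) = l • e 1 y) : C.IsEigenframeOn U e l μ := by
  obtain ⟨α, β, a, b, c, hw⟩ := he.exists_coefficients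
  have hα : ∀ y ∈ U, α y = l := fun y hy ↦ by
    have h := congrArg (fun v ↦ g.inner y v (e 1 y)) ((hw.h_one hy).symm.trans (h1 y hy))
    simpa [he.orthonormal y hy] using h
  have hβ : ∀ y ∈ U, β y = 0 := fun y hy ↦ by
    have h := congrArg (fun v ↦ g.inner y v (e 2 y)) ((hw.h_one hy).symm.trans (h1 y hy))
    simpa [he.orthonormal y hy] using h
  refine ⟨he, .const _, .const _, fun y hy ↦ ?_, fun y hy ↦ ?_, fun y hy ↦ ?_⟩ <;>
    obtain ⟨ha, hb, hc⟩ := hw.coefficients_eq hC hl hα hβ hy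
  · rw [hw.bracket_zero_one y hy, hα y hy, hβ y hy, ha]
  · rw [hw.bracket_zero_two y hy, hα y hy, hβ y hy, ha]
  · rw [hw.bracket_one_two y hy, hb, hc]

/-- As `h² = l²` on the contact distribution, the fields `(h + l) e₁` and `(h + l) e₂` are
eigenvectors of `h`, and one of them does not vanish at the given point. -/
theorem IsKappaMu.exists_eigenframe (hC : C.IsKappaMu κ μ) (hl : l ≠ 0) (hκ : κ = 1 - l ^ 2)
    (p : M) : ∃ U e, p ∈ U ∧ C.IsEigenframeOn U e l μ := by
  obtain ⟨U, e, hp, he'⟩ := C.exists_adaptedFrame p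
  obtain ⟨α, β, a, b, c, he⟩ := he'.exists_coefficients
  have hU := he.isOpen
  have hk : ∀ y ∈ U, α y ^ 2 + β y ^ 2 = l ^ 2 := fun y hy ↦ by
    have := he.kappa_eq hC hy
    linarith
  obtain ⟨X, hX, hη, hh, h0⟩ : ∃ X : VF E M, SmoothOn X U ∧ (∀ y ∈ U, C.η y (X y) = 0) ∧
      (∀ y ∈ U, C.h y (X y) = l • X y) ∧ X p ≠ 0 := by
    by_cases h : α p + l = 0
    · refine ⟨fun y ↦ β y • e 1 y + (l - α y) • e 2 y, ((he.smooth 1).smul he.smooth_β).add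
        ((he.smooth 2).smul ((SmoothFunOn.const l).sub he.smooth_α)), fun y hy ↦ ?_, fun y hy ↦ ?_,
        fun h2 ↦ ?_⟩
      · simp [he.η_frame hy]
      · simp only [map_add, map_smul, he.h_one hy, he.h_two hy]
        have e2 : β y * β y = (l - α y) * (l + α y) := by linear_combination hk y hy
        rw [smul_add, smul_add, smul_smul, smul_smul (β y) (β y), e2]
        module
      · have h3 := congrArg (fun v ↦ g.inner p v (e 2 p)) h2
        simp [he.orthonormal p hp] at h3
        exact hl (by linarith)
    · refine ⟨fun y ↦ (α y + l) • e 1 y + β y • e 2 y, ((he.smooth 1).smul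
        (he.smooth_α.add (.const l))).add ((he.smooth 2).smul he.smooth_β), fun y hy ↦ ?_,
        fun y hy ↦ ?_, fun h2 ↦ ?_⟩
      · simp [he.η_frame hy]
      · simp only [map_add, map_smul, he.h_one hy, he.h_two hy]
        have e2 : β y * β y = (l - α y) * (l + α y) := by linear_combination hk y hy
        rw [smul_sub, smul_smul (β y) (β y), e2]
        module
      · have h3 := congrArg (fun v ↦ g.inner p v (e 1 p)) h2
        simp [he.orthonormal p hp] at h3
        exact h h3
  obtain ⟨V, hVU, hpV, e', he', f, hf⟩ := C.exists_isAdaptedFrameOn hU hp hX hη h0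
  refine ⟨V, e', hpV, he'.isEigenframeOn hC hl fun y hy ↦ ?_⟩
  rw [hf y hy, map_smul, hh y (hVU hy), smul_comm]

/-- In an eigenframe, Boeckx's tensor field is `S(e i) (e j) = -∇_{e i} (e j)`, that is, the frame is
parallel for `∇ + S`. -/
theorem IsAdaptedFrameWith.ambroseSinger_boeckx (he : C.IsEigenframeOn U e l μ) (hx : x ∈ U)
    (j : Fin 3) : ambroseSinger g (C.boeckx μ) (e j) x = 0 := by
  obtain ⟨l0, l1, l2, l3, l4, l5, l6, l7, l8⟩ := he.leviCivita_frame hx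
  have o := he.orthonormal x hx
  have p0 : C.φh x (e 0 x) = 0 := by
    simp [φh, he.h_zero hx, he.φ_zero hx]
  have p1 : C.φh x (e 1 x) = (1 + l) • e 2 x := by
    simp [φh, he.h_one hx, he.φ_one x hx, add_smul]
  have p2 : C.φh x (e 2 x) = (l - 1) • e 1 x := by
    simp [φh, he.h_two hx, he.φ_two hx, sub_smul]
    abel
  have key : ∀ i, ambroseSinger g (C.boeckx μ) (e j) x (e i x) = 0 := by
    intro i
    rw [ambroseSinger_apply, boeckx_apply]
    match i, j with
    | 0, 0 => simp [l0, p0, he.φ_zero hx]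
    | 0, 1 => simp [l3, p0, he.φ_one x hx, he.η_frame hx]; module
    | 0, 2 => simp [l6, p0, he.φ_two hx, he.η_frame hx]; module
    | 1, 0 => simp [l1, p1, he.φ_zero hx, he.η_frame hx, o]
    | 1, 1 => simp [l4, p1, he.η_frame hx, o]
    | 1, 2 => simp [l7, p1, he.η_frame hx, o, he.ξ_eq x hx]
    | 2, 0 => simp [l2, p2, he.φ_zero hx, he.η_frame hx, o]; module
    | 2, 1 => simp [l5, p2, he.η_frame hx, o, he.ξ_eq x hx]
    | 2, 2 => simp [l8, p2, he.η_frame hx, o]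
  refine ContinuousLinearMap.ext fun v ↦ ?_
  rw [he.expand hx v, map_sum]
  simp [key]

theorem IsAdaptedFrameWith.isUnimodularFrameOn (he : C.IsEigenframeOn U e l μ) :
    C.IsUnimodularFrameOn U e (1 - l - μ / 2) (1 + l - μ / 2) where
  smooth := he.smooth
  orthonormal := he.orthonormal
  ξ_eq := he.ξ_eq
  φ_one := he.φ_one
  φ_two x hx := he.φ_two hx
  bracket_zero_one x hx := by rw [he.bracket_zero_one x hx]; module
  bracket_one_two x hx := by rw [he.bracket_one_two x hx]; module
  bracket_two_zero x hx := by rw [mlieBracket_swap_apply, he.bracket_zero_two x hx]; module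

end ContactStructure

end AdaptedFrames

section SmoothTensors

variable {E : Type*} [NormedAddCommGroup E] [NormedSpace ℝ E] [FiniteDimensional ℝ E]
  {M : Type*} [TopologicalSpace M] [ChartedSpace E M] [IsManifold 𝓘(ℝ, E) ∞ M]

/-! ### Smoothness of tensor fields -/

/-- A field of continuous linear maps on a finite-dimensional space is smooth if its values at each
fixed vector are. -/
theorem contMDiffAt_clm_of_apply {F : Type*} [NormedAddCommGroup F] [NormedSpace ℝ F]
    {L : M → E →L[ℝ] F} {p : M} (h : ∀ v, ContMDiffAt 𝓘(ℝ, E) 𝓘(ℝ, F) ∞ (fun x ↦ L x v) p) :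
    ContMDiffAt 𝓘(ℝ, E) 𝓘(ℝ, E →L[ℝ] F) ∞ L p := by
  let b := Module.finBasis ℝ E
  let c : ∀ i, E →L[ℝ] ℝ := fun i ↦ LinearMap.toContinuousLinearMap (b.coord i)
  have e : L = fun x ↦ ∑ i, ContinuousLinearMap.smulRightL ℝ E F (c i) (L x (b i)) := by
    funext x
    ext v
    conv_lhs => rw [← b.sum_repr v, map_sum]
    simp [c]
  rw [e]
  exact ContMDiffAt.sum fun i _ ↦
    (ContinuousLinearMap.smulRightL ℝ E F (c i)).contMDiff.contMDiffAt.comp p (h (b i))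

/-- A field of linear maps from the tangent bundle to a vector bundle is smooth if it maps smooth
local vector fields to smooth sections. -/
theorem contMDiffAt_hom_of_apply {F : Type*} [NormedAddCommGroup F] [NormedSpace ℝ F]
    {V : M → Type*} [TopologicalSpace (TotalSpace F V)] [∀ x, AddCommGroup (V x)]
    [∀ x, Module ℝ (V x)] [∀ x, TopologicalSpace (V x)] [∀ x, IsTopologicalAddGroup (V x)]
    [∀ x, ContinuousSMul ℝ (V x)] [FiberBundle F V] [VectorBundle ℝ F V]
    {T : ∀ x : M, TangentSpace 𝓘(ℝ, E) x →L[ℝ] V x} {p : M}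
    (h : ∀ (U : Set M) (X : VF E M), IsOpen U → p ∈ U → SmoothOn X U →
      ContMDiffAt 𝓘(ℝ, E) (𝓘(ℝ, E).prod 𝓘(ℝ, F)) ∞
        (fun x ↦ TotalSpace.mk' F (E := V) x (T x (X x))) p) :
    ContMDiffAt 𝓘(ℝ, E) (𝓘(ℝ, E).prod 𝓘(ℝ, E →L[ℝ] F)) ∞
      (fun x ↦ TotalSpace.mk' (E →L[ℝ] F)
        (E := fun x : M ↦ TangentSpace 𝓘(ℝ, E) x →L[ℝ] V x) x (T x)) p := by
  rw [contMDiffAt_hom_bundle]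
  refine ⟨contMDiffAt_id, contMDiffAt_clm_of_apply fun v ↦ ?_⟩
  let t := trivializationAt E (fun x : M ↦ TangentSpace 𝓘(ℝ, E) x) p
  let t' := trivializationAt F V p
  -- it suffices to apply `T` to a field whose coordinates are constant near `p`
  let v₀ : TangentSpace 𝓘(ℝ, E) p := t.symm p v
  have hp : p ∈ t.baseSet := FiberBundle.mem_baseSet_trivializationAt' p
  have hp' : p ∈ t'.baseSet := FiberBundle.mem_baseSet_trivializationAt' p
  obtain ⟨s, hs, hX⟩ := FiberBundle.exists_contMDiffOn_extend (k := ∞) 𝓘(ℝ, E) E v₀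
  obtain ⟨U, hUs, hU, hx⟩ := mem_nhds_iff.1 hs
  have h1 := h U (FiberBundle.extend E v₀) hU hx (ContMDiffOn.mono hX hUs)
  rw [contMDiffAt_section] at h1
  refine h1.congr_of_eventuallyEq ?_
  filter_upwards [t.open_baseSet.mem_nhds hp, t'.open_baseSet.mem_nhds hp'] with y hy hy'
  have e1 : FiberBundle.extend E v₀ y = t.symm y v := by
    have : (t ⟨p, t.symm p v⟩).2 = v := by
      have := t.apply_mk_symm hp v
      exact congrArg Prod.snd this
    unfold FiberBundle.extend
    exact congrArg (t.symm y) this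
  rw [e1]
  simp only [ContinuousLinearMap.inCoordinates, ContinuousLinearMap.comp_apply]
  rw [Trivialization.symmL_apply _ hy]
  exact congrArg (fun f ↦ f (T y (t.symm y v))) (t'.coe_linearMapAt_of_mem (R := ℝ) hy')

/-- A tensor field of type `(1,2)` is smooth if it is so when evaluated on local vector fields. -/
theorem SmoothTensor12.of_apply {S : Tensor12 E M}
    (h : ∀ (U : Set M) (X Y : VF E M), IsOpen U → SmoothOn X U → SmoothOn Y U →
      SmoothOn (fun y ↦ S y (X y) (Y y)) U) : SmoothTensor12 S := fun p ↦ by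
  refine contMDiffAt_hom_of_apply (F := E →L[ℝ] E)
    (V := fun x : M ↦ TangentSpace 𝓘(ℝ, E) x →L[ℝ] TangentSpace 𝓘(ℝ, E) x)
    fun U X hU hp hX ↦ contMDiffAt_hom_of_apply fun V Y hV hp' hY ↦ ?_
  exact (h (U ∩ V) X Y (hU.inter hV) (hX.mono Set.inter_subset_left)
    (hY.mono Set.inter_subset_right)).contMDiffAt ((hU.inter hV).mem_nhds ⟨hp, hp'⟩)

namespace ContactStructure

variable {g : Metric E M} {C : ContactStructure g} {U : Set M} {X Y : VF E M} {x : M}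

theorem smoothOn_h (hU : IsOpen U) (hX : SmoothOn X U) : SmoothOn (fun y ↦ C.h y (X y)) U := by
  have hξ := C.smooth_ξ.smoothOn U
  refine (((hξ.mlieBracket hU (C.smooth_φ.apply hX)).sub
    (C.smooth_φ.apply (hξ.mlieBracket hU hX))).const_smul (2⁻¹ : ℝ)).congr fun y hy ↦ ?_
  rw [C.h_apply (hX.mdiffAt hU hy), hField]

variable (C) in
theorem smoothTensor12_boeckx (μ : ℝ) : SmoothTensor12 (C.boeckx μ) := by
  refine .of_apply fun U X Y hU hX hY ↦ ?_
  have h1 : SmoothOn (fun y ↦ C.φh y (X y)) U :=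
    (C.smooth_φ.apply (hX.add (smoothOn_h (C := C) hU hX))).congr fun y _ ↦ rfl
  have hξ := C.smooth_ξ.smoothOn U
  refine (((hξ.smul (h1.inner g hY)).neg.add ((C.smooth_φ.apply hY).smul
    ((SmoothFunOn.const (μ / 2)).mul (C.smooth_η.apply hX)))).add
      (h1.smul (C.smooth_η.apply hY))).congr fun y _ ↦ ?_
  rw [boeckx_apply]

/-- A skew-symmetric perturbation of the Levi-Civita connection is metric. -/
theorem isMetric_ambroseSinger {S : Tensor12 E M}
    (h : ∀ (x : M) (X Y Z : TangentSpace 𝓘(ℝ, E) x),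
      g.inner x (S x X Y) Z + g.inner x Y (S x X Z) = 0) : IsMetric g (ambroseSinger g S) := by
  intro X Y x hX hY v
  rw [leviCivita_isMetric g X Y x hX hY v, ambroseSinger_apply, ambroseSinger_apply, map_add,
    map_add, add_apply]
  linarith [h x v (X x) (Y x)]

variable (C) in
theorem isMetric_boeckx (μ : ℝ) : IsMetric g (ambroseSinger g (C.boeckx μ)) := by
  refine isMetric_ambroseSinger fun x X Y Z ↦ ?_
  have h1 := C.inner_φ_left Y Z
  have h2 := g.symm x (C.ξ x) Z
  simp only [boeckx_apply, map_add, map_neg, map_smul, add_apply, neg_apply, smul_apply,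
    smul_eq_mul, h1, h2, C.inner_ξ, g.symm x Y (C.φh x X)]
  ring

end ContactStructure

end SmoothTensors

section ParallelFrames

variable {E : Type*} [NormedAddCommGroup E] [NormedSpace ℝ E] [FiniteDimensional ℝ E]
  {M : Type*} [TopologicalSpace M] [ChartedSpace E M] [IsManifold 𝓘(ℝ, E) ∞ M]

/-! ### Orthonormal frames with constant connection coefficients -/

variable {g : Metric E M} {U : Set M} {e : Fin 3 → VF E M} {X Y Z : VF E M} {x : M}

/-- The component of `R(e i, e j) (e k)` along `e l` in an orthonormal frame with constant Christoffel
symbols `∇_{e i} (e j) = ∑ k, Γ i j k • e k`. -/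
noncomputable def curvatureCoeff (Γ : Fin 3 → Fin 3 → Fin 3 → ℝ) (i j k l : Fin 3) : ℝ :=
  ∑ m, (Γ j k m * Γ i m l - Γ i k m * Γ j m l - (Γ i j m - Γ j i m) * Γ m k l)

theorem Connection.parallel_combination {D : Connection E M} {ι : Type*} [Fintype ι]
    {t : ι → VF E M} (ht : ∀ i, MDiffAt (T% (t i)) x) (hpar : ∀ i, D (t i) x = 0) (c : ι → ℝ) :
    D (fun y ↦ ∑ i, c i • t i y) x = 0 := by
  refine ContinuousLinearMap.ext fun v ↦ ?_
  rw [Connection.sum_section D v Finset.univ (t := fun i y ↦ c i • t i y)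
    fun i _ ↦ mdifferentiableAt_const.smul_section (ht i)]
  simp [Connection.const_smul_section D v _ (ht _), hpar]

theorem mvfderiv_mul_mul {a b c : M → ℝ} (ha : MDiffAt a x) (hb : MDiffAt b x) (hc : MDiffAt c x)
    (v : TangentSpace 𝓘(ℝ, E) x) :
    mvfderiv 𝓘(ℝ, E) (fun y ↦ a y * b y * c y) x v =
      mvfderiv 𝓘(ℝ, E) a x v * b x * c x + a x * mvfderiv 𝓘(ℝ, E) b x v * c x
        + a x * b x * mvfderiv 𝓘(ℝ, E) c x v := by
  have hab : MDiffAt (fun y ↦ a y * b y) x := ha.mul hb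
  rw [mvfderiv_fun_mul hab hc, mvfderiv_fun_mul ha hb]
  simp
  ring

namespace IsOrthonormalFrameOn

variable {Γ : Fin 3 → Fin 3 → Fin 3 → ℝ}

/-- The brackets are recovered from `Γ` because `∇` has no torsion. -/
theorem curvature_frame (he : IsOrthonormalFrameOn g U e)
    (hΓ : ∀ y ∈ U, ∀ i j, leviCivita g (e j) y (e i y) = ∑ k, Γ i j k • e k y) (hx : x ∈ U)
    (i j k : Fin 3) :
    curvature (leviCivita g) (e i) (e j) (e k) x = ∑ l, curvatureCoeff Γ i j k l • e l x := by
  have hd := fun l ↦ (he.smooth l).mdiffAt he.isOpen hx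
  have key : ∀ i j k, leviCivita g (fun y ↦ leviCivita g (e k) y (e j y)) x (e i x) =
      ∑ m, Γ j k m • ∑ l, Γ i m l • e l x := by
    intro i j k
    have hs := SmoothOn.sum (s := Finset.univ) fun m _ ↦ (he.smooth m).const_smul (Γ j k m)
    rw [Connection.congr _ he.isOpen hx (fun y hy ↦ hΓ y hy j k) (hs.mdiffAt he.isOpen hx),
      Connection.sum_section _ _ _ (t := fun m y ↦ Γ j k m • e m y)
        fun m _ ↦ mdifferentiableAt_const.smul_section (hd m)]
    exact Finset.sum_congr rfl fun m _ ↦ by rw [Connection.const_smul_section _ _ _ (hd m), hΓ x hx]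
  have hb : mlieBracket 𝓘(ℝ, E) (e i) (e j) x = ∑ m, (Γ i j m - Γ j i m) • e m x := by
    have h := (CovariantDerivative.torsion_eq_zero_iff _).1 (leviCivita_torsion g) (hd i) (hd j)
    rw [← h, hΓ x hx, hΓ x hx, ← Finset.sum_sub_distrib]
    simp only [sub_smul]
  unfold curvature
  rw [key, key, hb, map_sum]
  simp only [map_smul, hΓ x hx, curvatureCoeff, Finset.sum_smul, Finset.smul_sum, smul_smul]
  rw [Finset.sum_comm, Finset.sum_comm (f := fun m l ↦ (Γ i k m * Γ j m l) • e l x),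
    Finset.sum_comm (f := fun m l ↦ ((Γ i j m - Γ j i m) * Γ m k l) • e l x)]
  simp only [← Finset.sum_sub_distrib, ← sub_smul]

theorem smoothOn_curvature (he : IsOrthonormalFrameOn g U e) [Fact (Module.finrank ℝ E = 3)]
    (hX : SmoothOn X U) (hY : SmoothOn Y U) (hZ : SmoothOn Z U) :
    SmoothOn (curvature (leviCivita g) X Y Z) U := by
  have hD := he.isSmoothConnectionOn U subset_rfl he.isOpen
  exact ((hD _ _ hX (hD _ _ hY hZ)).sub (hD _ _ hY (hD _ _ hX hZ))).sub
    (hD _ _ (hX.mlieBracket he.isOpen hY) hZ)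

variable [Fact (Module.finrank ℝ E = 3)] {S : Tensor12 E M}

/-- The curvature is parallel for a smooth metric connection `∇ + S` with a parallel frame in which
`∇` has constant coefficients. -/
theorem parallel_curvature (he : IsOrthonormalFrameOn g U e) (hS : SmoothTensor12 S)
    (hm : IsMetric g (ambroseSinger g S)) (hpar : ∀ y ∈ U, ∀ i, ambroseSinger g S (e i) y = 0)
    (hΓ : ∀ y ∈ U, ∀ i j, leviCivita g (e j) y (e i y) = ∑ k, Γ i j k • e k y) (hx : x ∈ U)
    {W : VF E M} (hW : SmoothOn W U) (hX : SmoothOn X U) (hY : SmoothOn Y U) (hZ : SmoothOn Z U) :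
    ambroseSinger g S (curvature (leviCivita g) X Y Z) x (W x) =
      curvature (leviCivita g) (fun y ↦ ambroseSinger g S X y (W y)) Y Z x
        + curvature (leviCivita g) X (fun y ↦ ambroseSinger g S Y y (W y)) Z x
        + curvature (leviCivita g) X Y (fun y ↦ ambroseSinger g S Z y (W y)) x := by
  have hU := he.isOpen
  have hd := fun l ↦ (he.smooth l).mdiffAt hU hx
  have hDS : ∀ {T : VF E M}, SmoothOn T U → SmoothOn (fun y ↦ ambroseSinger g S T y (W y)) U :=
    fun {T} hT ↦ (he.isSmoothConnectionOn U subset_rfl hU W T hW hT).add (hS.apply hW hT)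
  have hf : ∀ {T : VF E M}, SmoothOn T U → ∀ i, MDiffAt (fun y ↦ g.inner y (T y) (e i y)) x :=
    fun hT i ↦ (he.smooth_coeff hT i).mdiffAt hU hx
  have hR : ∀ i j k, MDiffAt (T% (curvature (leviCivita g) (e i) (e j) (e k))) x := fun i j k ↦
    (he.smoothOn_curvature (he.smooth i) (he.smooth j) (he.smooth k)).mdiffAt hU hx
  have hRpar : ∀ i j k, ambroseSinger g S (curvature (leviCivita g) (e i) (e j) (e k)) x = 0 := by
    intro i j k
    have hs := SmoothOn.sum (s := Finset.univ) fun l _ ↦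
      (he.smooth l).const_smul (curvatureCoeff Γ i j k l)
    rw [Connection.congr _ hU hx (fun y hy ↦ he.curvature_frame hΓ hy i j k) (hs.mdiffAt hU hx)]
    exact Connection.parallel_combination hd (hpar x hx) _
  have hs : ∀ i j k, SmoothFunOn E (fun y ↦ g.inner y (X y) (e i y) * g.inner y (Y y) (e j y) *
      g.inner y (Z y) (e k y)) U := fun i j k ↦
    ((he.smooth_coeff hX i).mul (he.smooth_coeff hY j)).mul (he.smooth_coeff hZ k)
  have h3 := fun i j k ↦ SmoothOn.smul (hs i j k)
    (he.smoothOn_curvature (he.smooth i) (he.smooth j) (he.smooth k))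
  have h2 := fun i j ↦ SmoothOn.sum (s := Finset.univ) fun k _ ↦ h3 i j k
  have h1 := fun i ↦ SmoothOn.sum (s := Finset.univ) fun j _ ↦ h2 i j
  have h0 := SmoothOn.sum (s := Finset.univ) fun i _ ↦ h1 i
  have hc := fun {T : VF E M} (hT : SmoothOn T U) i ↦ he.connection_eq hx hm (hpar x hx)
    (hT.mdiffAt hU hx) (W x) i
  rw [Connection.congr _ hU hx (fun y hy ↦ he.curvature_expand hy hX hY hZ)
      (h0.mdiffAt hU hx), Connection.sum_section _ _ _ (fun i _ ↦ (h1 i).mdiffAt hU hx),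
      he.curvature_expand hx (hDS hX) hY hZ, he.curvature_expand hx hX (hDS hY) hZ,
    he.curvature_expand hx hX hY (hDS hZ), ← Finset.sum_add_distrib, ← Finset.sum_add_distrib]
  refine Finset.sum_congr rfl fun i _ ↦ ?_
  rw [Connection.sum_section _ _ _ (fun j _ ↦ (h2 i j).mdiffAt hU hx),
    ← Finset.sum_add_distrib, ← Finset.sum_add_distrib]
  refine Finset.sum_congr rfl fun j _ ↦ ?_
  rw [Connection.sum_section _ _ _ (fun k _ ↦ (h3 i j k).mdiffAt hU hx),
    ← Finset.sum_add_distrib, ← Finset.sum_add_distrib]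
  refine Finset.sum_congr rfl fun k _ ↦ ?_
  rw [Connection.smul_section _ _ ((hs i j k).mdiffAt hU hx) (hR i j k), hRpar,
    mvfderiv_mul_mul (hf hX i) (hf hY j) (hf hZ k), hc hX, hc hY, hc hZ, ← add_smul, ← add_smul]
  simp

/-- The tensor field `S` is parallel for a smooth metric connection `∇ + S` with a parallel frame in
which `∇` has constant coefficients. -/
theorem parallel_self (he : IsOrthonormalFrameOn g U e) (hS : SmoothTensor12 S)
    (hm : IsMetric g (ambroseSinger g S)) (hpar : ∀ y ∈ U, ∀ i, ambroseSinger g S (e i) y = 0)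
    (hΓ : ∀ y ∈ U, ∀ i j, leviCivita g (e j) y (e i y) = ∑ k, Γ i j k • e k y) (hx : x ∈ U)
    (hX : SmoothOn X U) (hY : SmoothOn Y U) (v : TangentSpace 𝓘(ℝ, E) x) :
    ambroseSinger g S (fun y ↦ S y (X y) (Y y)) x v =
      S x (ambroseSinger g S X x v) (Y x) + S x (X x) (ambroseSinger g S Y x v) := by
  have hU := he.isOpen
  have hd := fun l ↦ (he.smooth l).mdiffAt hU hx
  have hf : ∀ {T : VF E M}, SmoothOn T U → ∀ i, MDiffAt (fun y ↦ g.inner y (T y) (e i y)) x :=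
    fun hT i ↦ (he.smooth_coeff hT i).mdiffAt hU hx
  have hc := fun {T : VF E M} (hT : SmoothOn T U) i ↦ he.connection_eq hx hm (hpar x hx)
    (hT.mdiffAt hU hx) v i
  have hSd : ∀ i j, MDiffAt (T% (fun y ↦ S y (e i y) (e j y))) x := fun i j ↦
    (hS.apply (he.smooth i) (he.smooth j)).mdiffAt hU hx
  have hSpar : ∀ i j, ambroseSinger g S (fun y ↦ S y (e i y) (e j y)) x = 0 := by
    intro i j
    have hs := SmoothOn.sum (s := Finset.univ) fun l _ ↦ (he.smooth l).const_smul (-Γ i j l)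
    rw [Connection.congr _ hU hx (fun y hy ↦ ?_) (hs.mdiffAt hU hx)]
    · exact Connection.parallel_combination hd (hpar x hx) _
    · have h := congrArg (fun L ↦ L (e i y)) (hpar y hy j)
      simp only [ambroseSinger_apply, zero_apply, hΓ y hy] at h
      simp only [neg_smul, Finset.sum_neg_distrib]
      exact (neg_eq_of_add_eq_zero_right h).symm
  have hexp : ∀ y ∈ U, ∀ a b : TangentSpace 𝓘(ℝ, E) y, S y a b =
      ∑ i, ∑ j, (g.inner y a (e i y) * g.inner y b (e j y)) • S y (e i y) (e j y) := by
    intro y hy a b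
    conv_lhs => rw [he.expand hy a, he.expand hy b]
    simp only [map_sum, sum_apply, map_smul, smul_apply, Finset.smul_sum, smul_smul]
    rw [Finset.sum_comm]
    simp only [mul_comm]
  have hs : ∀ i j, SmoothFunOn E (fun y ↦ g.inner y (X y) (e i y) * g.inner y (Y y) (e j y)) U :=
    fun i j ↦ (he.smooth_coeff hX i).mul (he.smooth_coeff hY j)
  have h2 := fun i j ↦ SmoothOn.smul (hs i j) (hS.apply (he.smooth i) (he.smooth j))
  have h1 := fun i ↦ SmoothOn.sum (s := Finset.univ) fun j _ ↦ h2 i j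
  have h0 := SmoothOn.sum (s := Finset.univ) fun i _ ↦ h1 i
  rw [Connection.congr _ hU hx (fun y hy ↦ hexp y hy (X y) (Y y))
      (h0.mdiffAt hU hx), Connection.sum_section _ _ _ (fun i _ ↦ (h1 i).mdiffAt hU hx),
    hexp x hx _ (Y x), hexp x hx (X x), ← Finset.sum_add_distrib]
  refine Finset.sum_congr rfl fun i _ ↦ ?_
  rw [Connection.sum_section _ _ _ (fun j _ ↦ (h2 i j).mdiffAt hU hx), ← Finset.sum_add_distrib]
  refine Finset.sum_congr rfl fun j _ ↦ ?_
  rw [Connection.smul_section _ _ ((hs i j).mdiffAt hU hx) (hSd i j), hSpar,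
      mvfderiv_fun_mul (hf hX i) (hf hY j),
    hc hX, hc hY, ← add_smul]
  simp
  ring_nf

end IsOrthonormalFrameOn

/-- A smooth tensor field `S` such that `∇ + S` is metric and has, near each point, a parallel
orthonormal frame in which `∇` has constant coefficients, is a homogeneous Riemannian structure. -/
theorem isHomogeneousStructure_of_parallel_frame [Fact (Module.finrank ℝ E = 3)]
    {S : Tensor12 E M} (hS : SmoothTensor12 S)
    (hm : IsMetric g (ambroseSinger g S)) (h : ∀ p : M, ∃ (U : Set M) (e : Fin 3 → VF E M)
      (Γ : Fin 3 → Fin 3 → Fin 3 → ℝ), p ∈ U ∧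
      IsOrthonormalFrameOn g U e ∧ (∀ y ∈ U, ∀ i, ambroseSinger g S (e i) y = 0) ∧
      ∀ y ∈ U, ∀ i j, leviCivita g (e j) y (e i y) = ∑ k, Γ i j k • e k y) :
    IsHomogeneousStructure g S where
  smooth := hS
  parallel_metric := hm
  parallel_curvature W X Y Z hW hX hY hZ x := by
    obtain ⟨U, e, Γ, hx, he, hpar, hΓ⟩ := h x
    exact he.parallel_curvature hS hm hpar hΓ hx (hW.smoothOn U) (hX.smoothOn U) (hY.smoothOn U)
      (hZ.smoothOn U)
  parallel_self W X Y hW hX hY x := by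
    obtain ⟨U, e, Γ, hx, he, hpar, hΓ⟩ := h x
    exact he.parallel_self hS hm hpar hΓ hx (hX.smoothOn U) (hY.smoothOn U) (W x)

end ParallelFrames

/-! ### Boeckx's tensor field as a homogeneous structure -/

section Eigenframes

variable {E : Type*} [NormedAddCommGroup E] [NormedSpace ℝ E] [FiniteDimensional ℝ E]
  {M : Type*} [TopologicalSpace M] [ChartedSpace E M] [IsManifold 𝓘(ℝ, E) ∞ M]

namespace ContactStructure

/-- The Christoffel symbols `g(∇_{e i} (e j), e k)` of an eigenframe. -/
noncomputable def eigenChristoffel (l μ : ℝ) : Fin 3 → Fin 3 → Fin 3 → ℝ :=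
  ![![![0, 0, 0], ![0, 0, -μ / 2], ![0, μ / 2, 0]],
    ![![0, 0, -(1 + l)], ![0, 0, 0], ![1 + l, 0, 0]],
    ![![0, 1 - l, 0], ![l - 1, 0, 0], ![0, 0, 0]]]

variable {g : Metric E M} {C : ContactStructure g} {U : Set M} {e : Fin 3 → VF E M}
  {x : M} [T2Space M] [hE : Fact (Module.finrank ℝ E = 3)] {κ μ l : ℝ}

theorem IsAdaptedFrameWith.leviCivita_eigenframe (he : C.IsEigenframeOn U e l μ) (hx : x ∈ U)
    (i j : Fin 3) :
    leviCivita g (e j) x (e i x) = ∑ k, eigenChristoffel l μ i j k • e k x := by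
  obtain ⟨l0, l1, l2, l3, l4, l5, l6, l7, l8⟩ := he.leviCivita_frame hx
  rw [Fin.sum_univ_three]
  match i, j with
  | 0, 0 => rw [l0]; simp [eigenChristoffel]
  | 0, 1 => rw [l3]; simp [eigenChristoffel]
  | 0, 2 => rw [l6]; simp [eigenChristoffel]; module
  | 1, 0 => rw [l1]; simp [eigenChristoffel]; module
  | 1, 1 => rw [l4]; simp [eigenChristoffel]
  | 1, 2 => rw [l7]; simp [eigenChristoffel]
  | 2, 0 => rw [l2]; simp [eigenChristoffel]
  | 2, 1 => rw [l5]; simp [eigenChristoffel]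
  | 2, 2 => rw [l8]; simp [eigenChristoffel]

theorem IsKappaMu.isHomogeneousStructure_boeckx (hC : C.IsKappaMu κ μ) (hl : l ≠ 0)
    (hκ : κ = 1 - l ^ 2) : IsHomogeneousStructure g (C.boeckx μ) :=
  isHomogeneousStructure_of_parallel_frame (C.smoothTensor12_boeckx μ) (C.isMetric_boeckx μ)
    fun p ↦ by
      obtain ⟨U, e, hp, he⟩ := hC.exists_eigenframe hl hκ p
      exact ⟨U, e, eigenChristoffel l μ, hp, he.toIsOrthonormalFrameOn,
        fun y hy i ↦ he.ambroseSinger_boeckx hy i, fun y hy i j ↦ he.leviCivita_eigenframe hy i j⟩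

end ContactStructure

end Eigenframes

section Uniqueness

variable {E : Type*} [NormedAddCommGroup E] [NormedSpace ℝ E] [FiniteDimensional ℝ E]
  {M : Type*} [TopologicalSpace M] [ChartedSpace E M] [IsManifold 𝓘(ℝ, E) ∞ M]

/-! ### Homogeneous structures in an orthonormal frame -/

variable {g : Metric E M} {U : Set M} {e : Fin 3 → VF E M} {X Y Z : VF E M} {x : M}
  {Γ : Fin 3 → Fin 3 → Fin 3 → ℝ} {S : Tensor12 E M} [T2Space M]
  [Fact (Module.finrank ℝ E = 3)]

namespace IsOrthonormalFrameOn

theorem smoothOn_ambroseSinger (he : IsOrthonormalFrameOn g U e) (hS : SmoothTensor12 S)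
    (hX : SmoothOn X U) (hY : SmoothOn Y U) :
    SmoothOn (fun y ↦ ambroseSinger g S Y y (X y)) U :=
  (he.isSmoothConnectionOn U subset_rfl he.isOpen X Y hX hY).add (hS.apply hX hY)

/-- Parallelism of the curvature, for locally defined fields. -/
theorem homogeneous_curvature (he : IsOrthonormalFrameOn g U e) (hS : IsHomogeneousStructure g S)
    (hx : x ∈ U) {W : VF E M} (hW : SmoothOn W U) (hX : SmoothOn X U) (hY : SmoothOn Y U)
    (hZ : SmoothOn Z U) :
    ambroseSinger g S (curvature (leviCivita g) X Y Z) x (W x) =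
      curvature (leviCivita g) (fun y ↦ ambroseSinger g S X y (W y)) Y Z x
        + curvature (leviCivita g) X (fun y ↦ ambroseSinger g S Y y (W y)) Z x
        + curvature (leviCivita g) X Y (fun y ↦ ambroseSinger g S Z y (W y)) x := by
  obtain ⟨W', hW', V₀, h₀, o₀, m₀, e₀⟩ := hW.exists_smooth_extension he.isOpen hx
  obtain ⟨X', hX', V₁, h₁, o₁, m₁, e₁⟩ := hX.exists_smooth_extension he.isOpen hx
  obtain ⟨Y', hY', V₂, h₂, o₂, m₂, e₂⟩ := hY.exists_smooth_extension he.isOpen hx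
  obtain ⟨Z', hZ', V₃, h₃, o₃, m₃, e₃⟩ := hZ.exists_smooth_extension he.isOpen hx
  obtain ⟨V, hVo, hxV, hV₀, hV₁, hV₂, hV₃⟩ : ∃ V : Set M, IsOpen V ∧ x ∈ V ∧ V ⊆ V₀ ∧ V ⊆ V₁ ∧
      V ⊆ V₂ ∧ V ⊆ V₃ := ⟨V₀ ∩ V₁ ∩ (V₂ ∩ V₃), (o₀.inter o₁).inter (o₂.inter o₃),
    ⟨⟨m₀, m₁⟩, m₂, m₃⟩, fun _ h ↦ h.1.1, fun _ h ↦ h.1.2, fun _ h ↦ h.2.1, fun _ h ↦ h.2.2⟩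
  have hVU := hV₀.trans h₀
  have he' := he.mono hVo hVU
  have hD := he'.isSmoothConnectionOn
  replace hW := hW.mono hVU
  replace hX := hX.mono hVU
  replace hY := hY.mono hVU
  replace hZ := hZ.mono hVU
  have eX := fun y hy ↦ e₁ y (hV₁ hy)
  have eY := fun y hy ↦ e₂ y (hV₂ hy)
  have eZ := fun y hy ↦ e₃ y (hV₃ hy)
  have eD : ∀ {T T' : VF E M}, SmoothOn T V → (∀ y ∈ V, T' y = T y) → ∀ y ∈ V,
      ambroseSinger g S T' y (W' y) = ambroseSinger g S T y (W y) := fun hT h y hy ↦ by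
    rw [Connection.congr _ hVo hy h (hT.mdiffAt hVo hy), e₀ y (hV₀ hy)]
  have hDS : ∀ {T : VF E M}, SmoothOn T V → SmoothOn (fun y ↦ ambroseSinger g S T y (W y)) V :=
    fun hT ↦ he'.smoothOn_ambroseSinger hS.smooth hW hT
  have h := hS.parallel_curvature W' X' Y' Z' hW' hX' hY' hZ' x
  rwa [Connection.congr _ hVo hxV (fun y hy ↦ curvature_congr hD hVo hy hX hY hZ eX eY eZ)
      ((he'.smoothOn_curvature hX hY hZ).mdiffAt hVo hxV), e₀ x m₀,
    curvature_congr hD hVo hxV (hDS hX) hY hZ (eD hX eX) eY eZ,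
    curvature_congr hD hVo hxV hX (hDS hY) hZ eX (eD hY eY) eZ,
    curvature_congr hD hVo hxV hX hY (hDS hZ) eX eY (eD hZ eZ)] at h

/-- Parallelism of `S`, for locally defined fields. -/
theorem homogeneous_self (he : IsOrthonormalFrameOn g U e) (hS : IsHomogeneousStructure g S)
    (hx : x ∈ U) {W : VF E M} (hW : SmoothOn W U) (hX : SmoothOn X U) (hY : SmoothOn Y U) :
    ambroseSinger g S (fun y ↦ S y (X y) (Y y)) x (W x) =
      S x (ambroseSinger g S X x (W x)) (Y x) + S x (X x) (ambroseSinger g S Y x (W x)) := by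
  obtain ⟨W', hW', V₀, h₀, o₀, m₀, e₀⟩ := hW.exists_smooth_extension he.isOpen hx
  obtain ⟨X', hX', V₁, h₁, o₁, m₁, e₁⟩ := hX.exists_smooth_extension he.isOpen hx
  obtain ⟨Y', hY', V₂, h₂, o₂, m₂, e₂⟩ := hY.exists_smooth_extension he.isOpen hx
  have h := hS.parallel_self W' X' Y' hW' hX' hY' x
  have hU := he.isOpen
  rwa [Connection.congr _ (o₁.inter o₂) ⟨m₁, m₂⟩ (X := fun y ↦ S y (X y) (Y y))
      (fun y hy ↦ by rw [e₁ y hy.1, e₂ y hy.2])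
      ((hS.smooth.apply hX hY).mdiffAt hU hx),
    Connection.congr _ o₁ m₁ e₁ (hX.mdiffAt hU hx), Connection.congr _ o₂ m₂ e₂ (hY.mdiffAt hU hx),
    e₀ x m₀, e₁ x m₁, e₂ x m₂] at h

/-- The components `g(D_v (e i), e j)` of a metric connection `D` are skew-symmetric in `i`, `j`. -/
theorem inner_connection_skew (he : IsOrthonormalFrameOn g U e) {D : Connection E M}
    (hD : IsMetric g D) (hx : x ∈ U) (v : TangentSpace 𝓘(ℝ, E) x) (i j : Fin 3) :
    g.inner x (D (e i) x v) (e j x) = -g.inner x (D (e j) x v) (e i x) := by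
  have h := hD (e i) (e j) x ((he.smooth i).mdiffAt he.isOpen hx)
    ((he.smooth j).mdiffAt he.isOpen hx) v
  rw [dInner, he.mvfderiv_inner_eq_zero hx, zero_apply, g.symm x (e i x)] at h
  linarith

/-- For a homogeneous structure `S`, the connection form `τ` of `∇ + S` in the direction `e w`, acting
as a derivation, annihilates the curvature: the components of the curvature are constant. -/
theorem homogeneous_curvature_coeff (he : IsOrthonormalFrameOn g U e)
    (hS : IsHomogeneousStructure g S)
    (hΓ : ∀ y ∈ U, ∀ i j, leviCivita g (e j) y (e i y) = ∑ k, Γ i j k • e k y) (hx : x ∈ U)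
    (w i j k p : Fin 3) {τ : Fin 3 → Fin 3 → ℝ}
    (hτ : ∀ i m, g.inner x (ambroseSinger g S (e i) x (e w x)) (e m x) = τ i m) :
    ∑ l, curvatureCoeff Γ i j k l * τ l p =
      ∑ m, (τ i m * curvatureCoeff Γ m j k p + τ j m * curvatureCoeff Γ i m k p
        + τ k m * curvatureCoeff Γ i j m p) := by
  have hU := he.isOpen
  have s := he.smooth
  have hD := he.isSmoothConnectionOn
  have hd := fun l ↦ (s l).mdiffAt hU hx
  have h := he.homogeneous_curvature hS hx (s w) (s i) (s j) (s k)
  have hs := SmoothOn.sum (s := Finset.univ) fun l _ ↦ (s l).const_smul (curvatureCoeff Γ i j k l)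
  have hDS := fun i ↦ he.smoothOn_ambroseSinger hS.smooth (s w) (s i)
  have e1 := he.curvature_expand_left hx (hDS i) (s j) (s k)
  have e2 : curvature (leviCivita g) (e i) (fun y ↦ ambroseSinger g S (e j) y (e w y)) (e k) x =
      ∑ m, τ j m • curvature (leviCivita g) (e i) (e m) (e k) x := by
    rw [curvature_swap, he.curvature_expand_left hx (hDS j) (s i) (s k), ← Finset.sum_neg_distrib]
    exact Finset.sum_congr rfl fun m _ ↦ by rw [hτ, ← smul_neg, ← curvature_swap]
  have e3 := he.curvature_expand_right hx (s i) (s j) (hDS k)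
  rw [Connection.congr _ hU hx (fun y hy ↦ he.curvature_frame hΓ hy i j k) (hs.mdiffAt hU hx),
    Connection.sum_section _ _ _ (t := fun m y ↦ curvatureCoeff Γ i j k m • e m y)
      (fun l _ ↦ ((s l).const_smul _).mdiffAt hU hx),
    e1, e2, e3] at h
  simp only [Connection.const_smul_section _ _ _ (hd _), hτ, he.curvature_frame hΓ hx] at h
  have h' := congrArg (fun v ↦ g.inner x v (e p x)) h
  simp only [map_add, map_sum, map_smul, add_apply, sum_apply, smul_apply, smul_eq_mul, hτ,
    he.orthonormal x hx] at h'
  simp only [mul_ite, mul_one, mul_zero, Finset.sum_ite_eq', Finset.mem_univ, if_true] at h'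
  rw [h']
  simp only [Finset.sum_add_distrib]

/-- A component of the identity `(∇ + S) S = 0` in a frame, for a component `σ i j p` of `S` that is
constant. -/
theorem homogeneous_self_coeff (he : IsOrthonormalFrameOn g U e)
    (hS : IsHomogeneousStructure g S) (hx : x ∈ U) (w i j p : Fin 3)
    {τ : Fin 3 → Fin 3 → ℝ} {σ : Fin 3 → Fin 3 → Fin 3 → ℝ}
    (hτ : ∀ i m, g.inner x (ambroseSinger g S (e i) x (e w x)) (e m x) = τ i m)
    (hσ : ∀ i j k, g.inner x (S x (e i x) (e j x)) (e k x) = σ i j k)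
    (hconst : ∀ y ∈ U, g.inner y (S y (e i y) (e j y)) (e p y) = σ i j p) :
    ∑ l, σ i j l * τ l p = ∑ m, (τ i m * σ m j p + τ j m * σ i m p) := by
  have hU := he.isOpen
  have s := he.smooth
  have hm := hS.parallel_metric (fun y ↦ S y (e i y) (e j y)) (e p) x
    ((hS.smooth.apply (s i) (s j)).mdiffAt hU hx) ((s p).mdiffAt hU hx) (e w x)
  rw [dInner, mvfderiv_congr hU hx hconst, mvfderiv_const, zero_apply,
    he.homogeneous_self hS hx (s w) (s i) (s j)] at hm
  have e1 := he.expand hx (ambroseSinger g S (e i) x (e w x))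
  have e2 := he.expand hx (ambroseSinger g S (e j) x (e w x))
  have e3 := he.expand hx (S x (e i x) (e j x))
  simp only [hτ, hσ] at e1 e2 e3
  rw [e1, e2, e3] at hm
  simp only [map_add, map_sum, map_smul, add_apply, sum_apply, smul_apply, smul_eq_mul, hσ] at hm
  have e4 : ∀ l, g.inner x (e l x) (ambroseSinger g S (e p) x (e w x)) = -τ l p := fun l ↦ by
    rw [g.symm, he.inner_connection_skew hS.parallel_metric hx, hτ]
  simp only [e4, mul_neg, Finset.sum_neg_distrib] at hm
  rw [Finset.sum_add_distrib]
  linarith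

end IsOrthonormalFrameOn

/-! ### Uniqueness of the homogeneous structure -/

namespace ContactStructure

variable {C : ContactStructure g} {κ μ l : ℝ}

/-- An eigenframe is parallel for `∇ + S` if `S` is a homogeneous structure and the structure
constants are distinct. For the connection form `τ` of `∇ + S`, parallelism of the curvature gives
`(ρ_i - ρ_j) τ_{ij} = 0` for the three Ricci eigenvalues `2 (1 - l²)`, `-μ (1 - l)`, `-μ (1 + l)`.
Two of these coincide if `μ = 0` or `l = 1`; then `(∇ + S) S = 0` takes care of the remaining
component. -/
theorem IsAdaptedFrameWith.ambroseSinger_eq_zero (he : C.IsEigenframeOn U e l μ) (hl : 0 < l)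
    (hμ : (2 + μ) ^ 2 ≠ 4 * l ^ 2) (hS : IsHomogeneousStructure g S) (hx : x ∈ U) (i : Fin 3) :
    ambroseSinger g S (e i) x = 0 := by
  have ho := he.toIsOrthonormalFrameOn
  obtain ⟨τ, hτ⟩ : ∃ τ : M → Fin 3 → Fin 3 → Fin 3 → ℝ, ∀ y w i m,
      g.inner y (ambroseSinger g S (e i) y (e w y)) (e m y) = τ y w i m := ⟨_, fun _ _ _ _ ↦ rfl⟩
  have hskew : ∀ y ∈ U, ∀ w i m, τ y w i m = -τ y w m i := fun y hy w i m ↦ by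
    rw [← hτ, ← hτ, ho.inner_connection_skew hS.parallel_metric hy]
  have hdiag : ∀ y ∈ U, ∀ w i, τ y w i i = 0 := fun y hy w i ↦ by linarith [hskew y hy w i i]
  have hΓ := fun y hy ↦ he.leviCivita_eigenframe (x := y) hy
  have hσ : ∀ y ∈ U, ∀ i j k, g.inner y (S y (e i y) (e j y)) (e k y) =
      τ y i j k - eigenChristoffel l μ i j k := fun y hy i j k ↦ by
    have h := hτ y i j k
    rw [ambroseSinger_apply, hΓ y hy, map_add, add_apply, map_sum, sum_apply] at h
    simp only [map_smul, smul_apply, ho.orthonormal y hy, smul_eq_mul, mul_ite, mul_one, mul_zero,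
      Finset.sum_ite_eq', Finset.mem_univ, if_true] at h
    linarith
  -- the factors of `(2 + μ)² - 4 l²`
  have hp : 2 * (1 - l) + μ ≠ 0 := fun h ↦ hμ (by rw [show μ = 2 * (l - 1) by linarith]; ring)
  have hn : 2 * (1 + l) + μ ≠ 0 := fun h ↦ hμ (by rw [show μ = -2 * (1 + l) by linarith]; ring)
  have h12 : ∀ y ∈ U, ∀ w, μ * τ y w 1 2 = 0 := fun y hy w ↦ by
    have h := ho.homogeneous_curvature_coeff hS hΓ hy w 0 1 0 2 (hτ y w)
    simp [Fin.sum_univ_three, curvatureCoeff, eigenChristoffel, hdiag y hy w] at h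
    refine (mul_eq_zero.1 (?_ : l * (μ * τ y w 1 2) = 0)).resolve_left hl.ne'
    linear_combination -h / 2
  have h02 : ∀ y ∈ U, ∀ w, τ y w 0 2 = 0 := fun y hy w ↦ by
    have h := ho.homogeneous_curvature_coeff hS hΓ hy w 0 1 1 2 (hτ y w)
    simp [Fin.sum_univ_three, curvatureCoeff, eigenChristoffel, hdiag y hy w] at h
    refine (mul_eq_zero.1 (?_ : ((1 + l) * (2 * (1 - l) + μ)) * τ y w 0 2 = 0)).resolve_left
      (mul_ne_zero (by linarith) hp)
    linear_combination h
  have h01 : ∀ y ∈ U, ∀ w, (1 - l) * τ y w 0 1 = 0 := fun y hy w ↦ by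
    have h := ho.homogeneous_curvature_coeff hS hΓ hy w 0 2 2 1 (hτ y w)
    simp [Fin.sum_univ_three, curvatureCoeff, eigenChristoffel, hdiag y hy w] at h
    refine (mul_eq_zero.1 (?_ : (2 * (1 + l) + μ) * ((1 - l) * τ y w 0 1) = 0)).resolve_left hn
    linear_combination h
  have h12' : ∀ w, τ x w 1 2 = 0 := fun w ↦ by
    by_cases hμ0 : μ = 0
    · have hl1 : 1 - l ≠ 0 := fun h ↦ hp (by rw [h, hμ0]; ring)
      have h01' : ∀ y ∈ U, ∀ w, τ y w 0 1 = 0 := fun y hy w ↦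
        (mul_eq_zero.1 (h01 y hy w)).resolve_left hl1
      have h := ho.homogeneous_self_coeff hS hx w 1 0 1 (hτ x w) (hσ x hx) fun y hy ↦ by
        rw [hσ y hy, h01' y hy, h01' x hx]
      simp [Fin.sum_univ_three, eigenChristoffel, hdiag x hx, h01' x hx, h02 x hx,
        hskew x hx _ 1 0, hskew x hx _ 2 1] at h
      exact (mul_eq_zero.1 (by linear_combination h / 2 : l * τ x w 1 2 = 0)).resolve_left hl.ne'
    · exact (mul_eq_zero.1 (h12 x hx w)).resolve_left hμ0
  have h01' : ∀ w, τ x w 0 1 = 0 := fun w ↦ by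
    by_cases hl1 : l = 1
    · have h := ho.homogeneous_self_coeff hS hx w 0 2 0 (hτ x w) (hσ x hx) fun y hy ↦ by
        rw [hσ y hy, hskew y hy _ 2 0, hskew x hx _ 2 0, h02 y hy, h02 x hx]
      simp [Fin.sum_univ_three, eigenChristoffel, hdiag x hx, h02 x hx, h12',
        hskew x hx _ 1 0, hskew x hx _ 2 0, hskew x hx _ 2 1] at h
      exact (mul_eq_zero.1 (by linear_combination 2 * h :
        (2 * (1 + l) + μ) * τ x w 0 1 = 0)).resolve_left hn
    · exact (mul_eq_zero.1 (h01 x hx w)).resolve_left fun h ↦ hl1 (by linarith)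
  have hzero : ∀ w m, τ x w i m = 0 := fun w m ↦ by
    have h10 := hskew x hx w 1 0
    have h20 := hskew x hx w 2 0
    have h21 := hskew x hx w 2 1
    rw [h01', neg_zero] at h10
    rw [h02 x hx, neg_zero] at h20
    rw [h12', neg_zero] at h21
    match i, m with
    | 0, 0 => exact hdiag x hx w 0
    | 0, 1 => exact h01' w
    | 0, 2 => exact h02 x hx w
    | 1, 0 => exact h10
    | 1, 1 => exact hdiag x hx w 1
    | 1, 2 => exact h12' w
    | 2, 0 => exact h20
    | 2, 1 => exact h21
    | 2, 2 => exact hdiag x hx w 2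
  refine ContinuousLinearMap.ext fun v ↦ ?_
  rw [ho.expand hx v, map_sum]
  refine Finset.sum_eq_zero fun w _ ↦ ?_
  rw [map_smul, ho.expand hx (ambroseSinger g S (e i) x (e w x))]
  simp [hτ, hzero]

/-- Both `∇ + S` and the connection of Boeckx's tensor field make an eigenframe parallel. -/
theorem IsKappaMu.homogeneousStructure_unique (hC : C.IsKappaMu κ μ) (hl : 0 < l)
    (hκ : κ = 1 - l ^ 2) (hμ : (2 + μ) ^ 2 ≠ 4 * l ^ 2) (hS : IsHomogeneousStructure g S) :
    S = C.boeckx μ := by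
  funext x
  obtain ⟨U, e, hx, he⟩ := hC.exists_eigenframe hl.ne' hκ x
  ext v w
  rw [he.expand hx w, map_sum, map_sum]
  refine Finset.sum_congr rfl fun i _ ↦ ?_
  rw [map_smul, map_smul]
  have h1 := congrArg (fun L ↦ L v) (he.ambroseSinger_eq_zero hl hμ hS hx i)
  have h2 := congrArg (fun L ↦ L v) (he.ambroseSinger_boeckx hx i)
  simp only [ambroseSinger_apply] at h1 h2
  rw [add_left_cancel (h1.trans h2.symm)]

end ContactStructure

end Uniqueness

section LieGroups

/-! ### Left invariant vector fields and local isomorphisms into a Lie group -/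

variable {E : Type*} [NormedAddCommGroup E] [NormedSpace ℝ E] [FiniteDimensional ℝ E]
  {G : Type*} [TopologicalSpace G] [ChartedSpace E G] [Group G] [LieGroup 𝓘(ℝ, E) ∞ G]

instance lieGroup_minSmoothness_three : LieGroup 𝓘(ℝ, E) (minSmoothness ℝ 3) G :=
  LieGroup.of_le (n := ∞) (by
    rw [minSmoothness_of_isRCLikeNormedField]; exact WithTop.coe_le_coe.2 (le_top : (3 : ℕ∞) ≤ ⊤))

/-- Left invariant vector fields are smooth: at `a` the field is the value of the differential of
the multiplication at `(0, v) ∈ T_(a, 1) (G × G)`. -/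
theorem smooth_mulInvariantVectorField (v : GroupLieAlgebra 𝓘(ℝ, E) G) :
    Smooth (mulInvariantVectorField v) := by
  let fg : G → TangentBundle 𝓘(ℝ, E) G := fun g ↦ TotalSpace.mk' E g 0
  have sfg : ContMDiff 𝓘(ℝ, E) 𝓘(ℝ, E).tangent ∞ fg := contMDiff_zeroSection ℝ _
  let fv : G → TangentBundle 𝓘(ℝ, E) G := fun _ ↦ TotalSpace.mk' E 1 v
  have sfv : ContMDiff 𝓘(ℝ, E) 𝓘(ℝ, E).tangent ∞ fv := contMDiff_const
  have S₁ := sfg.prodMk sfv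
  have S₂ : ContMDiff _ _ ∞ (equivTangentBundleProd 𝓘(ℝ, E) G 𝓘(ℝ, E) G).symm :=
    contMDiff_equivTangentBundleProd_symm
  have S₃ : ContMDiff _ _ ∞ (tangentMap (𝓘(ℝ, E).prod 𝓘(ℝ, E)) 𝓘(ℝ, E)
      (fun p : G × G ↦ p.1 * p.2)) :=
    ContMDiff.contMDiff_tangentMap (m := ∞) (n := ∞) (contMDiff_mul 𝓘(ℝ, E) ∞) le_rfl
  have S := (S₃.comp S₂).comp S₁
  refine S.congr fun a ↦ ?_
  have key : ∀ (b c : G) (w : E), b = c →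
      (TotalSpace.mk' E b (w : TangentSpace 𝓘(ℝ, E) b) : TangentBundle 𝓘(ℝ, E) G) =
        TotalSpace.mk' E c (w : TangentSpace 𝓘(ℝ, E) c) := by
    rintro b _ w rfl
    rfl
  have hd := (contMDiff_mul 𝓘(ℝ, E) ∞ (G := G)).mdifferentiableAt (x := (a, 1)) (by simp)
  let w : TangentSpace (𝓘(ℝ, E).prod 𝓘(ℝ, E)) ((a, 1) : G × G) := ((0 : E), (v : E))
  have h1 : mfderiv (𝓘(ℝ, E).prod 𝓘(ℝ, E)) 𝓘(ℝ, E) (fun p : G × G ↦ p.1 * p.2) (a, 1) w =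
      mfderiv 𝓘(ℝ, E) 𝓘(ℝ, E) (fun z : G ↦ z * 1) a 0
        + mfderiv 𝓘(ℝ, E) 𝓘(ℝ, E) (fun z : G ↦ a * z) 1 v := mfderiv_prod_eq_add_apply hd
  rw [map_zero, zero_add] at h1
  exact (key a (a * 1) _ (mul_one a).symm).trans (congrArg (TotalSpace.mk' E (a * 1)) h1.symm)

section

variable {M : Type*} [TopologicalSpace M] [ChartedSpace E M] [IsManifold 𝓘(ℝ, E) ∞ M]
  {g : Metric E M} {C : ContactStructure g} {g' : Metric E G} {C' : ContactStructure g'}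
  {f : M → G} {U : Set M} {x : M}

/-- The pullback to `M`, under a local isomorphism `f : M → G`, of the left invariant vector field
on `G` with value `v` at the identity. -/
noncomputable def invariantPullback (f : M → G) (v : GroupLieAlgebra 𝓘(ℝ, E) G) : VF E M :=
  mpullback 𝓘(ℝ, E) 𝓘(ℝ, E) f (mulInvariantVectorField v)

theorem invariantPullback_add (f : M → G) (v w : GroupLieAlgebra 𝓘(ℝ, E) G) (x : M) :
    invariantPullback f (v + w) x = invariantPullback f v x + invariantPullback f w x := by
  simp [invariantPullback, mulInvariantVectorField_add, mpullback_apply]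

theorem invariantPullback_smul (f : M → G) (c : ℝ) (v : GroupLieAlgebra 𝓘(ℝ, E) G) (x : M) :
    invariantPullback f (c • v) x = c • invariantPullback f v x := by
  simp [invariantPullback, mulInvariantVectorField_smul, mpullback_apply]

namespace IsLocalIsomorphismOn

variable (hf : IsLocalIsomorphismOn C C' f U) (hx : x ∈ U)
include hf hx

theorem injective_mfderiv : Function.Injective (mfderiv 𝓘(ℝ, E) 𝓘(ℝ, E) f x) := by
  refine (injective_iff_map_eq_zero _).2 fun v hv ↦ ?_
  by_contra hne
  have h := hf.metric x hx v v
  rw [hv, map_zero] at h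
  exact (g.pos x v hne).ne h

theorem isInvertible_mfderiv : (mfderiv 𝓘(ℝ, E) 𝓘(ℝ, E) f x).IsInvertible :=
  ⟨(LinearEquiv.ofInjectiveOfFinrankEq
    (V := TangentSpace 𝓘(ℝ, E) x) (V' := TangentSpace 𝓘(ℝ, E) (f x))
    (mfderiv 𝓘(ℝ, E) 𝓘(ℝ, E) f x).toLinearMap
    (hf.injective_mfderiv hx) rfl).toContinuousLinearEquiv, by ext; rfl⟩

theorem mfderiv_invariantPullback (v : GroupLieAlgebra 𝓘(ℝ, E) G) :
    mfderiv 𝓘(ℝ, E) 𝓘(ℝ, E) f x (invariantPullback f v x) = mulInvariantVectorField v (f x) :=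
  (hf.isInvertible_mfderiv hx).self_apply_inverse _

theorem φ_invariantPullback (hC' : IsLeftInvariant C') (v : GroupLieAlgebra 𝓘(ℝ, E) G) :
    C.φ x (invariantPullback f v x) = invariantPullback f (C'.φ 1 v) x :=
  hf.injective_mfderiv hx <| by
    rw [← hf.φ x hx, hf.mfderiv_invariantPullback hx, hf.mfderiv_invariantPullback hx, hC'.φ]

theorem ξ_eq_invariantPullback (hC' : IsLeftInvariant C') :
    C.ξ x = invariantPullback f (C'.ξ 1) x :=
  hf.injective_mfderiv hx <| by rw [hf.ξ x hx, hf.mfderiv_invariantPullback hx, hC'.ξ]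

theorem inner_invariantPullback (hC' : IsLeftInvariant C') (v w : GroupLieAlgebra 𝓘(ℝ, E) G) :
    g.inner x (invariantPullback f v x) (invariantPullback f w x) = g'.inner 1 v w := by
  rw [← hf.metric x hx, hf.mfderiv_invariantPullback hx, hf.mfderiv_invariantPullback hx,
    hC'.metric]

omit hx in
theorem smoothOn_invariantPullback (hU : IsOpen U) (v : GroupLieAlgebra 𝓘(ℝ, E) G) :
    SmoothOn (invariantPullback f v) U := fun x hx ↦
  (ContMDiffAt.mpullback_vectorField_preimage (m := ∞) (n := ∞)
    (smooth_mulInvariantVectorField v (f x)) (hf.smooth.contMDiffAt (hU.mem_nhds hx))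
    (hf.isInvertible_mfderiv hx) le_rfl).contMDiffWithinAt

theorem mlieBracket_invariantPullback (hU : IsOpen U) (v w : GroupLieAlgebra 𝓘(ℝ, E) G) :
    mlieBracket 𝓘(ℝ, E) (invariantPullback f v) (invariantPullback f w) x =
      invariantPullback f ⁅v, w⁆ x := by
  unfold invariantPullback
  rw [GroupLieAlgebra.bracket_def, mulInvariantVector_mlieBracket,
    mpullback_mlieBracket (n := ∞) ((smooth_mulInvariantVectorField v).mdiffAt _)
      ((smooth_mulInvariantVectorField w).mdiffAt _)
      (hf.smooth.contMDiffAt (hU.mem_nhds hx)) (by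
        rw [minSmoothness_of_isRCLikeNormedField]
        exact WithTop.coe_le_coe.2 (le_top : (2 : ℕ∞) ≤ ⊤))]

theorem bijective_invariantPullback (hC' : IsLeftInvariant C') :
    Function.Bijective fun v : GroupLieAlgebra 𝓘(ℝ, E) G ↦ invariantPullback f v x := by
  let L : GroupLieAlgebra 𝓘(ℝ, E) G →ₗ[ℝ] TangentSpace 𝓘(ℝ, E) x :=
    { toFun := fun v ↦ invariantPullback f v x
      map_add' := fun v w ↦ invariantPullback_add f v w x
      map_smul' := fun c v ↦ invariantPullback_smul f c v x }
  have hL : Function.Injective L := (injective_iff_map_eq_zero _).2 fun v hv ↦ by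
    by_contra hne
    have h := hf.inner_invariantPullback hx hC' v v
    have hv' : invariantPullback f v x = 0 := hv
    rw [hv', map_zero] at h
    exact (g'.pos 1 v hne).ne h
  exact (LinearEquiv.ofInjectiveOfFinrankEq (V := GroupLieAlgebra 𝓘(ℝ, E) G)
    (V' := TangentSpace 𝓘(ℝ, E) x) L hL rfl).bijective

/-- Naturality of the Levi-Civita connection: by the Koszul formula, both sides are determined by
brackets and inner products in the Lie algebra. -/
theorem mfderiv_leviCivita_invariantPullback (hC' : IsLeftInvariant C') (hU : IsOpen U)
    (v : GroupLieAlgebra 𝓘(ℝ, E) G) (X : TangentSpace 𝓘(ℝ, E) x) :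
    mfderiv 𝓘(ℝ, E) 𝓘(ℝ, E) f x (leviCivita g (invariantPullback f v) x X) =
      leviCivita g' (mulInvariantVectorField v) (f x) (mfderiv 𝓘(ℝ, E) 𝓘(ℝ, E) f x X) := by
  obtain ⟨a, rfl⟩ := (hf.bijective_invariantPullback hx hC').surjective X
  refine metric_ext g' fun Z _ ↦ ?_
  obtain ⟨z, hz⟩ := (hf.isInvertible_mfderiv hx).surjective (Z (f x))
  obtain ⟨b, rfl⟩ := (hf.bijective_invariantPullback hx hC').surjective z
  have s := hf.smoothOn_invariantPullback hU
  have i := fun y (hy : y ∈ U) ↦ hf.inner_invariantPullback hy hC'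
  have s' := fun v ↦ (smooth_mulInvariantVectorField (E := E) (G := G) v).smoothOn Set.univ
  have i' := fun y (_ : y ∈ Set.univ) v w ↦ hC'.metric v w y
  have br := fun v w ↦ (congrFun (mulInvariantVector_mlieBracket (I := 𝓘(ℝ, E)) (G := G) v w)
    (f x)).symm
  rw [← hz, hf.metric x hx]
  simp only [hf.mfderiv_invariantPullback hx]
  rw [inner_leviCivita_of_const g hU hx (s a) (s v) (s b) (fun y hy ↦ i y hy v b)
      (fun y hy ↦ i y hy a b) (fun y hy ↦ i y hy a v),
    inner_leviCivita_of_const g' isOpen_univ (Set.mem_univ _) (s' a) (s' v) (s' b)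
      (fun y hy ↦ i' y hy v b) (fun y hy ↦ i' y hy a b) (fun y hy ↦ i' y hy a v)]
  simp only [hf.mlieBracket_invariantPullback hx hU, hf.inner_invariantPullback hx hC', br,
    hC'.metric]
  rfl

/-- The pullbacks of left invariant vector fields are parallel for the connection of Boeckx's tensor
field. As the group structure is left invariant, `h` maps such pullbacks to such pullbacks, and an
eigenvector of `h` extends to an eigenframe consisting of them. -/
theorem ambroseSinger_boeckx_invariantPullback [T2Space M] [Fact (Module.finrank ℝ E = 3)]
    {κ μ l : ℝ} (hC : C.IsKappaMu κ μ) (hl : l ≠ 0) (hκ : κ = 1 - l ^ 2) (hC' : IsLeftInvariant C')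
    (hU : IsOpen U) (v : GroupLieAlgebra 𝓘(ℝ, E) G) :
    ambroseSinger g (C.boeckx μ) (invariantPullback f v) x = 0 := by
  obtain ⟨W, e, hxW, he⟩ := hC.exists_eigenframe hl hκ x
  obtain ⟨v₁, hv₁⟩ := (hf.bijective_invariantPullback hx hC').surjective (e 1 x)
  simp only at hv₁
  let u : Fin 3 → GroupLieAlgebra 𝓘(ℝ, E) G := ![C'.ξ 1, v₁, C'.φ 1 v₁]
  have hu : ∀ i, invariantPullback f (u i) x = e i x := fun i ↦ match i with
    | 0 => (hf.ξ_eq_invariantPullback hx hC').symm.trans (he.ξ_eq x hxW)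
    | 1 => hv₁
    | 2 => by rw [← he.φ_one x hxW, ← hv₁, hf.φ_invariantPullback hx hC']; rfl
  have s := hf.smoothOn_invariantPullback hU
  have he' : C.IsAdaptedFrameOn U fun i ↦ invariantPullback f (u i) :=
    { isOpen := hU
      smooth := fun i ↦ s (u i)
      orthonormal := fun y hy i j ↦ by
        rw [hf.inner_invariantPullback hy hC', ← hf.inner_invariantPullback hx hC', hu, hu,
          he.orthonormal x hxW]
      ξ_eq := fun y hy ↦ hf.ξ_eq_invariantPullback hy hC'
      φ_one := fun y hy ↦ hf.φ_invariantPullback hy hC' v₁ }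
  have hh : ∀ y ∈ U, C.h y (invariantPullback f v₁ y) =
      invariantPullback f
        ((2⁻¹ : ℝ) • (⁅C'.ξ 1, C'.φ 1 v₁⁆ + (-1 : ℝ) • C'.φ 1 ⁅C'.ξ 1, v₁⁆)) y := by
    intro y hy
    rw [C.h_apply ((s v₁).mdiffAt hU hy), ContactStructure.hField,
      mlieBracket_congr hU hy (fun z hz ↦ hf.ξ_eq_invariantPullback hz hC')
        (fun z hz ↦ hf.φ_invariantPullback hz hC' v₁),
      mlieBracket_congr hU hy (fun z hz ↦ hf.ξ_eq_invariantPullback hz hC') (fun _ _ ↦ rfl),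
      hf.mlieBracket_invariantPullback hy hU, hf.mlieBracket_invariantPullback hy hU,
      hf.φ_invariantPullback hy hC', invariantPullback_smul, invariantPullback_add,
      invariantPullback_smul]
    module
  have hw := (hf.bijective_invariantPullback hx hC').injective <|
    ((hh x hx).symm.trans (by
      rw [hv₁, he.h_one hxW, invariantPullback_smul, hv₁, zero_smul, add_zero]) :
      _ = invariantPullback f (l • v₁) x)
  have hE := he'.isEigenframeOn hC hl fun y hy ↦
    (hh y hy).trans (by rw [hw, invariantPullback_smul]; rfl)
  let c : Fin 3 → ℝ := fun i ↦ g.inner x (invariantPullback f v x) (invariantPullback f (u i) x)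
  have hsum : ∀ y, invariantPullback f (c 0 • u 0 + c 1 • u 1 + c 2 • u 2) y =
      ∑ i, c i • invariantPullback f (u i) y := fun y ↦ by
    simp only [invariantPullback_add, invariantPullback_smul, Fin.sum_univ_three]
  have hv : v = c 0 • u 0 + c 1 • u 1 + c 2 • u 2 :=
    (hf.bijective_invariantPullback hx hC').injective
      ((he'.expand hx (invariantPullback f v x)).trans (hsum x).symm)
  rw [hv, show invariantPullback f (c 0 • u 0 + c 1 • u 1 + c 2 • u 2) = _ from funext hsum]
  exact Connection.parallel_combination (fun i ↦ (s (u i)).mdiffAt hU hx)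
    (fun i ↦ hE.ambroseSinger_boeckx hx i) c

/-- Boeckx's tensor field corresponds to `∇⁽⁻⁾ - ∇` under a local isomorphism into a Lie group. -/
theorem correspondsToMinus [T2Space M] [Fact (Module.finrank ℝ E = 3)]
    {κ μ l : ℝ} (hC : C.IsKappaMu κ μ) (hl : l ≠ 0) (hκ : κ = 1 - l ^ 2) (hC' : IsLeftInvariant C')
    (hU : IsOpen U) (X Y : TangentSpace 𝓘(ℝ, E) x) (v : GroupLieAlgebra 𝓘(ℝ, E) G)
    (hY : mfderiv 𝓘(ℝ, E) 𝓘(ℝ, E) f x Y = mulInvariantVectorField v (f x)) :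
    mfderiv 𝓘(ℝ, E) 𝓘(ℝ, E) f x (C.boeckx μ x X Y) =
      -(leviCivita g' (mulInvariantVectorField v) (f x) (mfderiv 𝓘(ℝ, E) 𝓘(ℝ, E) f x X)) := by
  obtain rfl : invariantPullback f v x = Y :=
    hf.injective_mfderiv hx ((hf.mfderiv_invariantPullback hx v).trans hY.symm)
  have h := congrArg (fun L ↦ L X)
    (hf.ambroseSinger_boeckx_invariantPullback hx hC hl hκ hC' hU v)
  rw [← hf.mfderiv_leviCivita_invariantPullback hx hC' hU, ← map_neg]
  simp only [ambroseSinger_apply, zero_apply] at h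
  rw [eq_neg_of_add_eq_zero_right h]

end IsLocalIsomorphismOn

end

end LieGroups
end ContactKM

theorem mainTheorem4
    {M : Type*} [TopologicalSpace M] [T2Space M] [ChartedSpace (EuclideanSpace ℝ (Fin 3)) M]
    [IsManifold 𝓘(ℝ, EuclideanSpace ℝ (Fin 3)) ∞ M]
    (g : ContactKM.Metric (EuclideanSpace ℝ (Fin 3)) M) (C : ContactKM.ContactStructure g)
    (κ μ : ℝ) (hC : C.IsKappaMu κ μ) (hflat : ¬ ContactKM.IsFlat g) (hSas : ¬ C.IsSasakian) :
    -- Boeckx's tensor field is a homogeneous Riemannian structure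
    ContactKM.IsHomogeneousStructure g (C.boeckx μ) ∧
    -- it is locally `∇⁽⁻⁾ - ∇` for a unimodular Lie algebra with structure constants `2, c₂, c₃`
    (∃ c₂ c₃ : ℝ, c₂ ≠ c₃ ∧ κ = 1 - (c₂ - c₃) ^ 2 / 4 ∧ μ = 2 - (c₂ + c₃) ∧
      ∀ p : M, ∃ U : Set M, IsOpen U ∧ p ∈ U ∧
        ∃ e : Fin 3 → ContactKM.VF (EuclideanSpace ℝ (Fin 3)) M,
          C.IsUnimodularFrameOn U e c₂ c₃ ∧
          ∀ i, ∀ x ∈ U, ContactKM.ambroseSinger g (C.boeckx μ) (e i) x = 0) ∧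
    -- and it corresponds to `∇⁽⁻⁾ - ∇` under each local identification with a Lie group
    (∀ (G : Type*) [TopologicalSpace G] [T2Space G] [ChartedSpace (EuclideanSpace ℝ (Fin 3)) G]
      [Group G] [LieGroup 𝓘(ℝ, EuclideanSpace ℝ (Fin 3)) ∞ G]
      (g' : ContactKM.Metric (EuclideanSpace ℝ (Fin 3)) G) (C' : ContactKM.ContactStructure g')
      (f : M → G) (U : Set M), ContactKM.IsLeftInvariant C' → IsOpen U →
      ContactKM.IsLocalIsomorphismOn C C' f U →
      ContactKM.CorrespondsToMinusOn (C.boeckx μ) g' f U) ∧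
    -- and there is no other one, when `2, c₂, c₃` are distinct
    ((2 + μ) ^ 2 ≠ 4 * (1 - κ) →
      ∀ S : ContactKM.Tensor12 (EuclideanSpace ℝ (Fin 3)) M,
        ContactKM.IsHomogeneousStructure g S → S = C.boeckx μ) := by
  have : Fact (Module.finrank ℝ (EuclideanSpace ℝ (Fin 3)) = 3) := ⟨finrank_euclideanSpace_fin⟩
  have hκ1 := hC.kappa_lt_one hSas
  -- `l` is the positive eigenvalue of `h`
  obtain ⟨l, hl, hκ⟩ : ∃ l : ℝ, 0 < l ∧ κ = 1 - l ^ 2 :=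
    ⟨√(1 - κ), Real.sqrt_pos.2 (by linarith), by rw [Real.sq_sqrt (by linarith)]; ring⟩
  refine ⟨hC.isHomogeneousStructure_boeckx hl.ne' hκ,
    ⟨1 - l - μ / 2, 1 + l - μ / 2, fun h ↦ by linarith, by rw [hκ]; ring, by ring, fun p ↦ ?_⟩,
    fun G _ _ _ _ _ g' C' f U hC' hU hf x hx X Y v hY ↦
      hf.correspondsToMinus hx hC hl.ne' hκ hC' hU X Y v hY,
    fun hμ S hS ↦ hC.homogeneousStructure_unique hl hκ (fun h ↦ hμ (by rw [h, hκ]; ring)) hS⟩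
  obtain ⟨U, e, hp, he⟩ := hC.exists_eigenframe hl.ne' hκ p
  exact ⟨U, he.isOpen, hp, e, he.isUnimodularFrameOn, fun i x hx ↦ he.ambroseSinger_boeckx hx i⟩
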